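/- Let $g\ge 0$ and let $\mathbb G$ be $\mathrm{Sp}_{2g}$ or $\mathrm O_{g,g}$ (the automorphism group of the standard symplectic form, respectively of the standard hyperbolic symmetric form, of rank $2g$). Let $V=\mathbb C^{2g}$ be the defining representation of $\mathbb G(\mathbb C)$. Let $\Gamma\subset\mathbb G(\mathbb R)$ be an arithmetic subgroup, i.e. $\Gamma\cap\mathbb G(\mathbb Z)$ has finite index in both $\Gamma$ and $\mathbb G(\mathbb Z)$, and assume that $\Gamma$ is Zariski dense in $\mathbb G(\mathbb R)$. A finite-dimensional complex representation $r:\Gamma\to\mathrm{GL}(E)$ is called arithmetic if it extends to a holomorphic representation $\mathbb G(\mathbb C)\to\mathrm{GL}(E)$; it is arithmetic of degree $\le k$ if moreover, for such an extension, there is a $\mathbb G(\mathbb C)$-equivariant injective linear map $E\to\bigl(\bigoplus_{i=0}^{k}V^{\otimes i}\bigr)^m$ for some $m\in\mathbb N$. Then: (i) Each arithmetic representation of $\Gamma$ has finite degree, i.e. it is arithmetic of degree $\le k$ for some $k\in\mathbb N$. (ii) Each arithmetic representation of $\Gamma$ is a (finite) direct sum of irreducible subrepresentations. (iii) If $E$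 is an arithmetic representation of $\Gamma$ and $F\subset E$ is a subrepresentation, then $F$ is arithmetic, and for every $k$, if $E$ has degree $\le k$ then $F$ has degree $\le k$. (iv) If $E$ is an arithmetic representation of $\Gamma$ and $F\subset E$ is a subrepresentation, then $E/F$ is arithmetic, and for every $k$, if $E$ has degree $\le k$ then $E/F$ has degree $\le k$. -/

import Mathlib

open scoped TensorProduct

namespace ArithRep

/-- The two families of classical groups: `Sp_{2g}` and `O_{g,g}`. -/
inductive ClassicalType
  | symplectic
  | orthogonal

/-- The Gram matrix, on `R ^ g ⊕ R ^ g`, of the standard symplectic form, respectively of the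
standard hyperbolic symmetric form. -/
def form (T : ClassicalType) (g : ℕ) (R : Type*) [CommRing R] :
    Matrix (Fin g ⊕ Fin g) (Fin g ⊕ Fin g) R :=
  match T with
  | .symplectic => Matrix.J (Fin g) R
  | .orthogonal => LieAlgebra.Orthogonal.JD (Fin g) R

theorem form_map (T : ClassicalType) (g : ℕ) {R S : Type*} [CommRing R] [CommRing S]
    (f : R →+* S) : (form T g R).map f = form T g S := by
  cases T
  · have h : (-1 : Matrix (Fin g) (Fin g) R).map f = -1 := by
      rw [Matrix.map_neg f (map_neg f), Matrix.map_one f (map_zero f) (map_one f)]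
    simp [form, Matrix.J, Matrix.fromBlocks_map, h]
  · simp [form, LieAlgebra.Orthogonal.JD, Matrix.fromBlocks_map]

/-- The group `𝔾(R)` of `R`-points, `𝔾 = Sp_{2g}` or `𝔾 = O_{g,g}`: the invertible matrices
that preserve the form. -/
def points (T : ClassicalType) (g : ℕ) (R : Type*) [CommRing R] :
    Subgroup (GL (Fin g ⊕ Fin g) R) where
  carrier := {A | A.1.transpose * form T g R * A.1 = form T g R}
  one_mem' := by simp
  mul_mem' := by
    intro A B hA hB
    simp only [Set.mem_ofPred_eq, Units.val_mul, Matrix.transpose_mul] at *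
    calc B.1.transpose * A.1.transpose * form T g R * (A.1 * B.1)
        = B.1.transpose * (A.1.transpose * form T g R * A.1) * B.1 := by
          simp only [Matrix.mul_assoc]
      _ = form T g R := by rw [hA, hB]
  inv_mem' := by
    intro A hA
    simp only [Set.mem_ofPred_eq] at *
    have h1 : A.1 * (A⁻¹).1 = 1 := A.mul_inv
    have h2 : (A⁻¹).1.transpose * A.1.transpose = 1 := by
      rw [← Matrix.transpose_mul, h1, Matrix.transpose_one]
    calc (A⁻¹).1.transpose * form T g R * (A⁻¹).1
        = (A⁻¹).1.transpose * (A.1.transpose * form T g R * A.1) * (A⁻¹).1 := by rw [hA]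
      _ = ((A⁻¹).1.transpose * A.1.transpose) * form T g R * (A.1 * (A⁻¹).1) := by
          simp only [Matrix.mul_assoc]
      _ = form T g R := by rw [h1, h2, Matrix.one_mul, Matrix.mul_one]

/-- The matrix of an element of `𝔾(R)`. -/
def mat {T : ClassicalType} {g : ℕ} {R : Type*} [CommRing R] (A : points T g R) :
    Matrix (Fin g ⊕ Fin g) (Fin g ⊕ Fin g) R :=
  A.1.1

/-- The homomorphism `𝔾(R) → 𝔾(S)` induced by a ring homomorphism `R → S`, entry by entry. -/
def pointsMap (T : ClassicalType) (g : ℕ) {R S : Type*} [CommRing R] [CommRing S]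
    (f : R →+* S) : points T g R →* points T g S :=
  ((Matrix.GeneralLinearGroup.map f).comp (points T g R).subtype).codRestrict (points T g S)
    (by
      intro A
      have hA : A.1.1.transpose * form T g R * A.1.1 = form T g R := A.2
      change (A.1.1.map f).transpose * form T g S * A.1.1.map f = form T g S
      rw [← form_map T g f, ← Matrix.transpose_map, ← Matrix.map_mul, ← Matrix.map_mul, hA])

/-- A subgroup `Γ ≤ 𝔾(ℝ)` is arithmetic if `Γ ∩ 𝔾(ℤ)` has finite index in both `Γ`
and `𝔾(ℤ)`. -/
def IsArithmeticSubgroup {T : ClassicalType} {g : ℕ} (Γ : Subgroup (points T g ℝ)) : Prop :=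
  Subgroup.Commensurable Γ (pointsMap T g (Int.castRingHom ℝ)).range

/-- A subgroup `Γ ≤ 𝔾(ℝ)` is Zariski dense if every real polynomial in the matrix entries that
vanishes on `Γ` vanishes on `𝔾(ℝ)`. -/
def IsZariskiDense {T : ClassicalType} {g : ℕ} (Γ : Subgroup (points T g ℝ)) : Prop :=
  ∀ p : MvPolynomial ((Fin g ⊕ Fin g) × (Fin g ⊕ Fin g)) ℝ,
    (∀ A ∈ Γ, MvPolynomial.eval (fun ij => mat A ij.1 ij.2) p = 0) →
      ∀ A : points T g ℝ, MvPolynomial.eval (fun ij => mat A ij.1 ij.2) p = 0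

/-- The defining representation `V = ℂ ^ {2g}` of `𝔾(ℂ)`. -/
noncomputable def definingRep (T : ClassicalType) (g : ℕ) :
    Representation ℂ (points T g ℂ) (Fin g ⊕ Fin g → ℂ) where
  toFun A := (mat A).mulVecLin
  map_one' := Matrix.mulVecLin_one
  map_mul' A B := Matrix.mulVecLin_mul (mat A) (mat B)

/-- The representation `V^{⊗ k}` of `𝔾(ℂ)`. -/
noncomputable def tensorPowerRep (T : ClassicalType) (g k : ℕ) :
    Representation ℂ (points T g ℂ) (⨂[ℂ]^k (Fin g ⊕ Fin g → ℂ)) where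
  toFun A := PiTensorProduct.map fun _ => definingRep T g A
  map_one' := by
    simp only [map_one]
    exact PiTensorProduct.map_one
  map_mul' A B := by
    simp only [map_mul]
    exact PiTensorProduct.map_mul _ _

variable {T : ClassicalType} {g : ℕ} {E : Type*} [AddCommGroup E] [Module ℂ E]

/-- A (finite-dimensional) representation of `𝔾(ℂ)` is holomorphic if all its matrix coefficients
are holomorphic functions on the complex submanifold `𝔾(ℂ)` of the space of matrices, i.e. are
locally restrictions of holomorphic functions defined on open sets of matrices. -/
def IsHolomorphicRep (R : Representation ℂ (points T g ℂ) E) : Prop :=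
  ∀ (v : E) (φ : E →ₗ[ℂ] ℂ) (A : points T g ℂ),
    ∃ (U : Set (Matrix (Fin g ⊕ Fin g) (Fin g ⊕ Fin g) ℂ))
      (f : Matrix (Fin g ⊕ Fin g) (Fin g ⊕ Fin g) ℂ → ℂ),
      IsOpen U ∧ mat A ∈ U ∧ DifferentiableOn ℂ f U ∧
        ∀ B : points T g ℂ, mat B ∈ U → f (mat B) = φ (R B v)

/-- `R` is a holomorphic representation of `𝔾(ℂ)` that extends the representation `r` of
`Γ ≤ 𝔾(ℝ) ≤ 𝔾(ℂ)`. -/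
def IsHolomorphicExtension {Γ : Subgroup (points T g ℝ)} (r : Representation ℂ Γ E)
    (R : Representation ℂ (points T g ℂ) E) : Prop :=
  IsHolomorphicRep R ∧ ∀ γ : Γ, R (pointsMap T g Complex.ofRealHom γ) = r γ

/-- A complex representation of `Γ` is arithmetic if it is finite-dimensional and extends to a
holomorphic representation of `𝔾(ℂ)`. -/
def IsArithmeticRep {Γ : Subgroup (points T g ℝ)} (r : Representation ℂ Γ E) : Prop :=
  Module.Finite ℂ E ∧ ∃ R : Representation ℂ (points T g ℂ) E, IsHolomorphicExtension r R

/-- An arithmetic representation has degree at most `k` if, with an extension to `𝔾(ℂ)` as above,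
there is a `𝔾(ℂ)`-equivariant injection of `E` into
`(ℂ ⊕ V ⊕ V^{⊗ 2} ⊕ ⋯ ⊕ V^{⊗ k})^m` for some `m`. -/
def IsArithmeticRepOfDegreeLE {Γ : Subgroup (points T g ℝ)} (r : Representation ℂ Γ E)
    (k : ℕ) : Prop :=
  Module.Finite ℂ E ∧ ∃ R : Representation ℂ (points T g ℂ) E, IsHolomorphicExtension r R ∧
    ∃ (m : ℕ) (Φ : E →ₗ[ℂ] ((i : Fin (k + 1)) → Fin m → ⨂[ℂ]^(i : ℕ) (Fin g ⊕ Fin g → ℂ))),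
      Function.Injective Φ ∧
        ∀ (A : points T g ℂ) (x : E) (i : Fin (k + 1)) (j : Fin m),
          Φ (R A x) i j = tensorPowerRep T g i A (Φ x i j)

/-- The quotient representation `E / F` by a subrepresentation `F`. -/
noncomputable def quotientRep {G : Type*} [Group G] {r : Representation ℂ G E}
    (F : Subrepresentation r) : Representation ℂ G (E ⧸ F.toSubmodule) :=
  r.quotient F.toSubmodule fun γ _ hv => F.apply_mem_toSubmodule γ hv

end ArithRep

/-! Everything rests on the compact group `K` of unitary matrices in `𝔾(ℂ)`. By polar decomposition,
each `A` lies on the holomorphic curve `z ↦ A P^z` with `P = A* A`, which meets `K` along the whole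
line `Re z = -1/2`. A holomorphic function on `𝔾(ℂ)` that vanishes on `K` is therefore zero
(`IsHolFun.eq_zero_of_compactForm`), so `K`-equivariant maps between holomorphic representations are
`𝔾(ℂ)`-equivariant. Averaging over Haar measure on `K` then yields equivariant projections onto
stable subspaces.

Finite degree is a Peter–Weyl argument. On `K` the conjugates of the matrix entries are linear
combinations of entries, so by Stone–Weierstrass the monomials in the entries span a dense subspace
of `C(K, ℂ)`. These monomials are matrix coefficients of the `V^{⊗ i}`. Averaging rank-one maps `E →
V^{⊗ i}` shows that equivariant maps to tensor powers separate the points of `E`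
(`eq_zero_of_forall_equivariant`), and by finite dimension boundedly many `i` suffice. It also
follows that matrix coefficients are polynomial.

To pass from `Γ` to `𝔾(ℂ)`, let `F` be `Γ`-stable. Polynomial coefficients and Zariski density make
`F` stable under `𝔾(ℝ)`. The group `𝔾(ℂ)` is generated by transvections, respectively reflections,
and each of these lies on a holomorphic curve that is real on the real axis, so the identity theorem
makes `F` stable under `𝔾(ℂ)` (`stable_of_isZariskiDense`). No connectedness of the group is needed.
Complements, subrepresentations and quotients for `Γ` are thus those for `𝔾(ℂ)`. -/

namespace ArithRep

/-! ### Averaging and Stone–Weierstrass on a compact group. -/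

section CompactGroup

open MeasureTheory

variable {K : Type*} [TopologicalSpace K] [CompactSpace K]

/-- Continuity of a map to a complex vector space, tested on linear functionals. -/
def WeaklyContinuous {M : Type*} [AddCommGroup M] [Module ℂ M] (f : K → M) : Prop :=
  ∀ η : Module.Dual ℂ M, Continuous fun x => η (f x)

variable [MeasurableSpace K] [BorelSpace K] (μ : Measure K) [IsFiniteMeasure μ]

/-- The integral of a map to a finite-dimensional complex vector space, taken in coordinates. -/
noncomputable def weakIntegral {M : Type*} [AddCommGroup M] [Module ℂ M] [Module.Finite ℂ M]
    (f : K → M) : M :=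
  ∑ j, (∫ x, (Module.finBasis ℂ M).coord j (f x) ∂μ) • Module.finBasis ℂ M j

theorem integrable_of_continuous_compact {f : K → ℂ} (hf : Continuous f) : Integrable f μ :=
  hf.integrable_of_hasCompactSupport (HasCompactSupport.of_compactSpace f)

/-- This property determines the weak integral. Later identities are tested on functionals through
it, so no norm on `M` is needed. -/
theorem dual_weakIntegral {M : Type*} [AddCommGroup M] [Module ℂ M] [Module.Finite ℂ M]
    {f : K → M} (hf : WeaklyContinuous f) (η : Module.Dual ℂ M) :
    η (weakIntegral μ f) = ∫ x, η (f x) ∂μ := by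
  have h : ∀ x, η (f x) = ∑ j, (Module.finBasis ℂ M).coord j (f x) * η (Module.finBasis ℂ M j) := by
    intro x
    conv_lhs => rw [← (Module.finBasis ℂ M).sum_repr (f x), map_sum]
    simp only [map_smul, smul_eq_mul, Module.Basis.coord_apply]
  simp_rw [h]
  rw [integral_finsetSum _ fun j _ =>
    (integrable_of_continuous_compact μ (hf _)).mul_const _]
  simp [weakIntegral, integral_mul_const]

theorem eq_of_forall_dual {M : Type*} [AddCommGroup M] [Module ℂ M] {x y : M}
    (h : ∀ η : Module.Dual ℂ M, η x = η y) : x = y := by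
  rw [← sub_eq_zero, ← Module.forall_dual_apply_eq_zero_iff ℂ]
  intro η
  rw [map_sub, h, sub_self]

section Stone

/-- Integration against `F` is a continuous functional on `C(K, ℂ)` that kills all monomials in the
`e i`. By `hstar` their span is a star subalgebra, and by `hsep` it is dense. Hence the functional
kills `star F`, so `∫ ‖F‖² = 0`, and `F = 0` because open sets have positive measure. -/
theorem eq_zero_of_forall_integral_monomial [T2Space K] [μ.IsOpenPosMeasure] {ι : Type*}
    (e : ι → C(K, ℂ)) (hsep : ∀ x y, (∀ i, e i x = e i y) → x = y)
    (hstar : ∀ i, star (e i) ∈ Submodule.span ℂ (Set.range e)) (F : C(K, ℂ))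
    (hF : ∀ (k : ℕ) (a : Fin k → ι), ∫ x, (∏ s, e (a s) x) * F x ∂μ = 0) : F = 0 := by
  have hint : ∀ h : C(K, ℂ), Integrable (fun x => h x * F x) μ := fun h =>
    integrable_of_continuous_compact μ (by fun_prop)
  let L₀ : C(K, ℂ) →ₗ[ℂ] ℂ :=
    { toFun := fun h => ∫ x, h x * F x ∂μ
      map_add' := fun h h' => by
        simp only [ContinuousMap.add_apply, add_mul]
        exact integral_add (hint h) (hint h')
      map_smul' := fun c h => by
        simp only [ContinuousMap.smul_apply, smul_eq_mul, mul_assoc, RingHom.id_apply]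
        exact integral_const_mul _ _ }
  let L : C(K, ℂ) →L[ℂ] ℂ := L₀.mkContinuous (∫ x, ‖F x‖ ∂μ) fun h => by
    have hFi : Integrable (fun x => ‖F x‖) μ :=
      (integrable_of_continuous_compact μ F.continuous).norm
    calc ‖∫ x, h x * F x ∂μ‖ ≤ ∫ x, ‖F x‖ * ‖h‖ ∂μ := by
          refine norm_integral_le_of_norm_le (hFi.mul_const _) (Filter.Eventually.of_forall ?_)
          intro x
          rw [norm_mul, mul_comm]
          gcongr
          exact h.norm_coe_le_norm x
      _ = (∫ x, ‖F x‖ ∂μ) * ‖h‖ := integral_mul_const _ _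
  let S : StarSubalgebra ℂ C(K, ℂ) :=
    { Algebra.adjoin ℂ (Set.range e) with
      star_mem' := by
        intro a ha
        change star a ∈ Algebra.adjoin ℂ (Set.range e)
        induction ha using Algebra.adjoin_induction with
        | mem x hx =>
          obtain ⟨i, rfl⟩ := hx
          exact Algebra.span_le_adjoin ℂ _ (hstar i)
        | algebraMap c =>
          rw [← algebraMap_star_comm]
          exact Subalgebra.algebraMap_mem _ _
        | add x y _ _ hx hy => rw [star_add]; exact add_mem hx hy
        | mul x y _ _ hx hy => rw [star_mul]; exact mul_mem hy hx }
  have hmem : ∀ h, h ∈ S ↔ h ∈ Algebra.adjoin ℂ (Set.range e) := fun h => Iff.rfl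
  have htop : S.topologicalClosure = ⊤ := by
    apply ContinuousMap.starSubalgebra_topologicalClosure_eq_top_of_separatesPoints
    intro x y hxy
    by_contra hcon
    refine hxy (hsep x y fun i => ?_)
    by_contra hne
    exact hcon ⟨e i, ⟨e i, (hmem _).2 (Algebra.subset_adjoin ⟨i, rfl⟩), rfl⟩, hne⟩
  have hmon : ∀ h ∈ Submonoid.closure (Set.range e),
      ∃ (k : ℕ) (a : Fin k → ι), ∀ x, h x = ∏ s, e (a s) x := by
    intro h hh
    induction hh using Submonoid.closure_induction with
    | mem x hx =>
      obtain ⟨i, rfl⟩ := hx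
      exact ⟨1, fun _ => i, fun x => by simp⟩
    | one => exact ⟨0, Fin.elim0, fun x => by simp⟩
    | mul x y _ _ hx hy =>
      obtain ⟨k, a, ha⟩ := hx
      obtain ⟨l, b, hb⟩ := hy
      exact ⟨k + l, Fin.append a b, fun x => by simp [Fin.prod_univ_add, ha, hb]⟩
  have hLS : ∀ h ∈ S, L h = 0 := by
    intro h hh
    rw [hmem, ← Subalgebra.mem_toSubmodule, Algebra.adjoin_eq_span] at hh
    induction hh using Submodule.span_induction with
    | mem x hx =>
      obtain ⟨k, a, ha⟩ := hmon x hx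
      change ∫ y, x y * F y ∂μ = 0
      simp_rw [ha]
      exact hF k a
    | zero => exact map_zero L
    | add x y _ _ hx hy => rw [map_add, hx, hy, add_zero]
    | smul c x _ hx => rw [map_smul, hx, smul_zero]
  have hL : ∀ h, L h = 0 := by
    intro h
    have hh : h ∈ S.topologicalClosure := by rw [htop]; trivial
    have hcl : IsClosed {h | L h = 0} := isClosed_eq L.continuous continuous_const
    exact closure_minimal (fun x hx => hLS x hx) hcl hh
  have h0 : ∫ x, (star F) x * F x ∂μ = 0 := hL (star F)
  have h1 : ∫ x, ‖F x‖ ^ 2 ∂μ = 0 := by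
    have : ∀ x, (star F) x * F x = ((‖F x‖ ^ 2 : ℝ) : ℂ) := fun x => by
      simp [Complex.conj_mul']
    simp_rw [this] at h0
    rw [integral_complex_ofReal] at h0
    exact_mod_cast h0
  have h2 : (fun x => ‖F x‖ ^ 2) = 0 := by
    have hc : Continuous fun x => ‖F x‖ ^ 2 := by fun_prop
    rw [integral_eq_zero_iff_of_nonneg (fun x => by positivity)
      (hc.integrable_of_hasCompactSupport (HasCompactSupport.of_compactSpace _))] at h1
    exact (Continuous.ae_eq_iff_eq μ hc continuous_const).1 h1
  ext x
  have := congrFun h2 x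
  simpa using this

end Stone

section Averaging

variable [Group K] [IsTopologicalGroup K] [μ.IsMulLeftInvariant]
  {E W : Type*} [AddCommGroup E] [Module ℂ E] [Module.Finite ℂ E]
  [AddCommGroup W] [Module ℂ W] [Module.Finite ℂ W]
  (ρ : Representation ℂ K E) (σ : Representation ℂ K W)

omit [CompactSpace K] [MeasurableSpace K] [BorelSpace K] [Module.Finite ℂ E] in
theorem weaklyContinuous_conjugate (hρ : ∀ v, WeaklyContinuous fun x => ρ x v)
    (hσ : ∀ w, WeaklyContinuous fun x => σ x w) (S : E →ₗ[ℂ] W) (v : E) :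
    WeaklyContinuous fun x => σ x (S (ρ x⁻¹ v)) := by
  intro η
  have h : ∀ x, η (σ x (S (ρ x⁻¹ v))) = ∑ j, ((Module.finBasis ℂ W).coord j ∘ₗ S) (ρ x⁻¹ v) *
      η (σ x (Module.finBasis ℂ W j)) := by
    intro x
    conv_lhs => rw [← (Module.finBasis ℂ W).sum_repr (S (ρ x⁻¹ v)), map_sum, map_sum]
    simp only [map_smul, smul_eq_mul, Module.Basis.coord_apply, LinearMap.comp_apply]
  simp_rw [h]
  exact continuous_finsetSum _ fun j _ =>
    ((hρ v ((Module.finBasis ℂ W).coord j ∘ₗ S)).comp continuous_inv).mul (hσ _ η)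

omit [Module.Finite ℂ E] in
/-- Averaging a linear map over a compact group gives an intertwining map. -/
theorem exists_intertwiner_average (hρ : ∀ v, WeaklyContinuous fun x => ρ x v)
    (hσ : ∀ w, WeaklyContinuous fun x => σ x w) (S : E →ₗ[ℂ] W) :
    ∃ Φ : E →ₗ[ℂ] W, (∀ x v, Φ (ρ x v) = σ x (Φ v)) ∧
      ∀ (v : E) (η : Module.Dual ℂ W), η (Φ v) = ∫ x, η (σ x (S (ρ x⁻¹ v))) ∂μ := by
  have hc := weaklyContinuous_conjugate ρ σ hρ hσ S
  have key : ∀ (v : E) (η : Module.Dual ℂ W),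
      η (weakIntegral μ fun x => σ x (S (ρ x⁻¹ v))) = ∫ x, η (σ x (S (ρ x⁻¹ v))) ∂μ :=
    fun v η => dual_weakIntegral μ (hc v) η
  refine ⟨{ toFun := fun v => weakIntegral μ fun x => σ x (S (ρ x⁻¹ v)), map_add' := ?_,
            map_smul' := ?_ }, ?_, key⟩
  · intro v w
    refine eq_of_forall_dual fun η => ?_
    rw [map_add, key, key, key, ← integral_add (integrable_of_continuous_compact μ (hc v η))
      (integrable_of_continuous_compact μ (hc w η))]
    simp
  · intro c v
    refine eq_of_forall_dual fun η => ?_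
    rw [RingHom.id_apply, map_smul, key, key, smul_eq_mul, ← integral_const_mul]
    simp
  · intro y v
    refine eq_of_forall_dual fun η => ?_
    change η (weakIntegral μ fun x => σ x (S (ρ x⁻¹ (ρ y v)))) =
      (η ∘ₗ σ y) (weakIntegral μ fun x => σ x (S (ρ x⁻¹ v)))
    -- Left invariance of `μ`: substitute `y * x` for `x` in the first integral.
    rw [key, key, ← integral_mul_left_eq_self _ y]
    refine integral_congr_ae (Filter.Eventually.of_forall fun x => ?_)
    simp only [LinearMap.comp_apply]
    rw [← Module.End.mul_apply (ρ _) (ρ y), ← map_mul, map_mul σ, Module.End.mul_apply]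
    simp

/-- Weyl's unitary trick: a stable subspace admits an equivariant projection. -/
theorem exists_equivariant_projection_of_compact [IsProbabilityMeasure μ]
    (hρ : ∀ v, WeaklyContinuous fun x => ρ x v) (F : Submodule ℂ E)
    (hF : ∀ x, ∀ v ∈ F, ρ x v ∈ F) :
    ∃ π : E →ₗ[ℂ] E, (∀ v, π v ∈ F) ∧ (∀ v ∈ F, π v = v) ∧ ∀ x v, π (ρ x v) = ρ x (π v) := by
  obtain ⟨F', hF'⟩ := F.exists_isCompl
  -- Any linear projection onto `F` will do. Since `F` is stable, every conjugate of `S` maps into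
  -- `F` and fixes `F` pointwise, and the average inherits both properties.
  let S : E →ₗ[ℂ] E := F.subtype ∘ₗ F.projectionOnto F' hF'
  obtain ⟨Φ, hΦ, hint⟩ := exists_intertwiner_average μ ρ ρ hρ hρ S
  refine ⟨Φ, fun v => ?_, fun v hv => ?_, hΦ⟩
  · by_contra hcon
    obtain ⟨η, hη, hη'⟩ := Submodule.exists_le_ker_of_notMem hcon
    refine hη ?_
    rw [hint]
    have : ∀ x, η (ρ x (S (ρ x⁻¹ v))) = 0 := fun x =>
      hη' (hF x _ (Submodule.coe_mem _))
    simp [this]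
  · refine eq_of_forall_dual fun η => ?_
    rw [hint]
    have : ∀ x, ρ x (S (ρ x⁻¹ v)) = v := fun x => by
      have h1 : S (ρ x⁻¹ v) = ρ x⁻¹ v := by
        have := Submodule.projectionOnto_apply_left hF' ⟨ρ x⁻¹ v, hF _ v hv⟩
        simp only [S, LinearMap.comp_apply, Submodule.subtype_apply]
        exact congrArg Subtype.val this
      rw [h1]; simp
    simp [this]

end Averaging

end CompactGroup

/-! ### The form and the matrices preserving it. -/

section Form

open Matrix

/-- The sign `ε` with `B(y, x) = ε B(x, y)`. -/
def ClassicalType.sign (T : ClassicalType) (R : Type*) [CommRing R] : R :=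
  match T with
  | .symplectic => -1
  | .orthogonal => 1

variable (T : ClassicalType) (g : ℕ) (R : Type*) [CommRing R]

theorem sign_mul_sign : T.sign R * T.sign R = 1 := by
  cases T <;> simp [ClassicalType.sign]

theorem form_transpose : (form T g R)ᵀ = T.sign R • form T g R := by
  cases T
  · simp [form, ClassicalType.sign, Matrix.J_transpose]
  · simp [form, ClassicalType.sign, LieAlgebra.Orthogonal.JD, fromBlocks_transpose]

theorem form_mul_form : form T g R * form T g R = T.sign R • 1 := by
  cases T
  · simp [form, ClassicalType.sign, Matrix.J_squared]
  · simp [form, ClassicalType.sign, LieAlgebra.Orthogonal.JD, fromBlocks_multiply]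

theorem sign_smul_form_mul_form : (T.sign R • form T g R) * form T g R = 1 := by
  rw [smul_mul_assoc, form_mul_form, smul_smul, sign_mul_sign, one_smul]

theorem form_mul_sign_smul_form : form T g R * (T.sign R • form T g R) = 1 := by
  rw [mul_smul_comm, form_mul_form, smul_smul, sign_mul_sign, one_smul]

theorem form_conjTranspose : (form T g ℂ)ᴴ = T.sign ℂ • form T g ℂ := by
  rw [← form_transpose]
  exact congrArg transpose (form_map T g (starRingEnd ℂ))

variable {T g R}

/-- A matrix preserving the form, as a point of the group. -/
def mkPoint (M : Matrix (Fin g ⊕ Fin g) (Fin g ⊕ Fin g) R)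
    (h : Mᵀ * form T g R * M = form T g R) : points T g R :=
  have h1 : ((T.sign R • form T g R) * (Mᵀ * form T g R)) * M = 1 := by
    rw [Matrix.mul_assoc, h, sign_smul_form_mul_form]
  ⟨⟨M, (T.sign R • form T g R) * (Mᵀ * form T g R), mul_eq_one_comm.1 h1, h1⟩, h⟩

@[simp]
theorem mat_mkPoint (M : Matrix (Fin g ⊕ Fin g) (Fin g ⊕ Fin g) R)
    (h : Mᵀ * form T g R * M = form T g R) : mat (mkPoint M h) = M := rfl

theorem mat_injective : Function.Injective (mat : points T g R → _) := fun _ _ h =>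
  Subtype.ext (Units.ext h)

@[simp]
theorem mat_mul (A B : points T g R) : mat (A * B) = mat A * mat B := rfl

@[simp]
theorem mat_one : mat (1 : points T g R) = 1 := rfl

theorem mat_form (A : points T g R) : (mat A)ᵀ * form T g R * mat A = form T g R := A.2

theorem mat_injective_mulVec (A : points T g R) : Function.Injective (mat A).mulVec :=
  Function.LeftInverse.injective (g := (mat A⁻¹).mulVec) fun x => by
    rw [mulVec_mulVec, ← mat_mul, inv_mul_cancel, mat_one, one_mulVec]

/-- With `J` the form and `ε` its sign, `εJMᵀJ` is a left inverse of `M`, hence also a right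
inverse. The result says that `Mᵀ` preserves the form too. -/
theorem form_mul_transpose_of_preserves {M : Matrix (Fin g ⊕ Fin g) (Fin g ⊕ Fin g) R}
    (h : Mᵀ * form T g R * M = form T g R) : M * form T g R * Mᵀ = form T g R := by
  have h1 : ((T.sign R • form T g R) * (Mᵀ * form T g R)) * M = 1 := by
    rw [Matrix.mul_assoc, h, sign_smul_form_mul_form]
  have h2 := mul_eq_one_comm.1 h1
  calc M * form T g R * Mᵀ = M * form T g R * Mᵀ * (form T g R * (T.sign R • form T g R)) := by
        rw [form_mul_sign_smul_form, Matrix.mul_one]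
    _ = (M * ((T.sign R • form T g R) * (Mᵀ * form T g R))) * form T g R := by
        simp only [Matrix.mul_assoc, smul_mul_assoc, mul_smul_comm]
    _ = form T g R := by rw [h2, Matrix.one_mul]

end Form

/-! ### The compact form of `𝔾(ℂ)`. -/

section Compact

open Matrix

variable (T : ClassicalType) (g : ℕ)

/-- The maximal compact subgroup of unitary matrices in `𝔾(ℂ)`. -/
def compactForm : Subgroup (unitaryGroup (Fin g ⊕ Fin g) ℂ) where
  carrier := {U | U.1ᵀ * form T g ℂ * U.1 = form T g ℂ}
  one_mem' := by simp
  mul_mem' := by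
    intro A B hA hB
    simp only [Set.mem_ofPred_eq, Submonoid.coe_mul, transpose_mul] at *
    calc B.1ᵀ * A.1ᵀ * form T g ℂ * (A.1 * B.1)
        = B.1ᵀ * (A.1ᵀ * form T g ℂ * A.1) * B.1 := by simp only [Matrix.mul_assoc]
      _ = form T g ℂ := by rw [hA, hB]
  inv_mem' := by
    intro A hA
    simp only [Set.mem_ofPred_eq] at *
    have h1 : A.1 * (A⁻¹).1 = 1 := congrArg Subtype.val (mul_inv_cancel A)
    have h2 : (A⁻¹).1ᵀ * A.1ᵀ = 1 := by rw [← transpose_mul, h1, transpose_one]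
    calc (A⁻¹).1ᵀ * form T g ℂ * (A⁻¹).1
        = (A⁻¹).1ᵀ * (A.1ᵀ * form T g ℂ * A.1) * (A⁻¹).1 := by rw [hA]
      _ = ((A⁻¹).1ᵀ * A.1ᵀ) * form T g ℂ * (A.1 * (A⁻¹).1) := by simp only [Matrix.mul_assoc]
      _ = form T g ℂ := by rw [h1, h2, Matrix.one_mul, Matrix.mul_one]

/-- The inclusion of the compact form in `𝔾(ℂ)`. -/
def compactFormToPoints : compactForm T g →* points T g ℂ where
  toFun U := mkPoint U.1.1 U.2
  map_one' := mat_injective rfl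
  map_mul' _ _ := mat_injective rfl

@[simp]
theorem mat_compactFormToPoints (U : compactForm T g) :
    mat (compactFormToPoints T g U) = U.1.1 := rfl

theorem continuous_mat_compactFormToPoints :
    Continuous fun U : compactForm T g => mat (compactFormToPoints T g U) :=
  continuous_subtype_val.comp continuous_subtype_val

instance : CompactSpace (unitaryGroup (Fin g ⊕ Fin g) ℂ) := by
  have h1 : IsCompact {M : Matrix (Fin g ⊕ Fin g) (Fin g ⊕ Fin g) ℂ |
      ∀ i j, M i j ∈ Metric.closedBall (0 : ℂ) 1} := by
    have := isCompact_univ_pi fun _ : Fin g ⊕ Fin g =>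
      isCompact_univ_pi fun _ : Fin g ⊕ Fin g => isCompact_closedBall (0 : ℂ) 1
    convert! this using 1
    ext M
    exact ⟨fun h i _ j _ => h i j, fun h i j => h i trivial j trivial⟩
  have h2 : IsClosed (unitaryGroup (Fin g ⊕ Fin g) ℂ : Set (Matrix (Fin g ⊕ Fin g) (Fin g ⊕ Fin g) ℂ)) := by
    have : (unitaryGroup (Fin g ⊕ Fin g) ℂ : Set (Matrix (Fin g ⊕ Fin g) (Fin g ⊕ Fin g) ℂ)) = {M | M * star M = 1} := by
      ext M
      exact mem_unitaryGroup_iff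
    rw [this]
    exact isClosed_eq (by fun_prop) continuous_const
  refine isCompact_iff_compactSpace.1 (h1.of_isClosed_subset h2 fun M hM i j => ?_)
  rw [mem_closedBall_zero_iff]
  exact entry_norm_bound_of_unitary hM i j

instance : CompactSpace (compactForm T g) := by
  have h : IsClosed (compactForm T g : Set (unitaryGroup (Fin g ⊕ Fin g) ℂ)) := by
    refine isClosed_eq (f := fun U : unitaryGroup (Fin g ⊕ Fin g) ℂ =>
      U.1ᵀ * form T g ℂ * U.1) ?_ continuous_const
    fun_prop
  exact isCompact_iff_compactSpace.1 h.isCompact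

end Compact

/-! ### Holomorphic functions on `𝔾(ℂ)` are determined on the compact form. -/

section Holomorphic

open Matrix
open scoped ComplexOrder

variable {T : ClassicalType} {g : ℕ}

/-- Holomorphic functions on the complex submanifold `𝔾(ℂ)` of the space of matrices. -/
def IsHolFun (f : points T g ℂ → ℂ) : Prop :=
  ∀ A : points T g ℂ, ∃ (U : Set (Matrix (Fin g ⊕ Fin g) (Fin g ⊕ Fin g) ℂ))
    (F : Matrix (Fin g ⊕ Fin g) (Fin g ⊕ Fin g) ℂ → ℂ),
    IsOpen U ∧ mat A ∈ U ∧ DifferentiableOn ℂ F U ∧ ∀ B : points T g ℂ, mat B ∈ U → F (mat B) = f B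

attribute [local instance] Matrix.normedAddCommGroup Matrix.normedSpace

theorem IsHolFun.sub {f h : points T g ℂ → ℂ} (hf : IsHolFun f) (hh : IsHolFun h) :
    IsHolFun fun A => f A - h A := by
  intro A
  obtain ⟨U, F, hU, hA, hF, hFf⟩ := hf A
  obtain ⟨U', F', hU', hA', hF', hFh⟩ := hh A
  refine ⟨U ∩ U', fun M => F M - F' M, hU.inter hU', ⟨hA, hA'⟩, ?_, fun B hB => ?_⟩
  · exact DifferentiableOn.sub (hF.mono Set.inter_subset_left) (hF'.mono Set.inter_subset_right)
  · exact congrArg₂ _ (hFf B hB.1) (hFh B hB.2)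

theorem isHolFun_eval (p : MvPolynomial ((Fin g ⊕ Fin g) × (Fin g ⊕ Fin g)) ℂ) :
    IsHolFun fun A : points T g ℂ => MvPolynomial.eval (fun ij => mat A ij.1 ij.2) p := by
  intro A
  have h1 : ∀ i j, Differentiable ℂ fun M : Fin g ⊕ Fin g → Fin g ⊕ Fin g → ℂ => M i j := by
    intro i j
    fun_prop
  have h2 : Differentiable ℂ fun (M : Fin g ⊕ Fin g → Fin g ⊕ Fin g → ℂ)
      (ij : (Fin g ⊕ Fin g) × (Fin g ⊕ Fin g)) => M ij.1 ij.2 :=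
    differentiable_pi.2 fun ij => h1 ij.1 ij.2
  have h3 : Differentiable ℂ fun x : (Fin g ⊕ Fin g) × (Fin g ⊕ Fin g) → ℂ =>
      MvPolynomial.eval x p :=
    differentiableOn_univ.1 (AnalyticOnNhd.eval_mvPolynomial p).differentiableOn
  have h4 := h3.comp h2
  exact ⟨Set.univ, _, isOpen_univ, trivial, h4.differentiableOn, fun B _ => rfl⟩

/-- Agreement of `c` with `M` is asked only near `z`, because the curves of reflections used later
are given by their formula only away from finitely many points. -/
theorem IsHolFun.differentiableAt_comp {f : points T g ℂ → ℂ} (hf : IsHolFun f)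
    {c : ℂ → points T g ℂ} {M : ℂ → Matrix (Fin g ⊕ Fin g) (Fin g ⊕ Fin g) ℂ} {z : ℂ}
    (hc : ∀ᶠ w in nhds z, mat (c w) = M w) (hM : ∀ i j, DifferentiableAt ℂ (fun w => M w i j) z) :
    DifferentiableAt ℂ (fun w => f (c w)) z := by
  obtain ⟨U, F, hU, hz, hF, hFf⟩ := hf (c z)
  have h1 : DifferentiableAt ℂ M z :=
    differentiableAt_pi.2 fun i => differentiableAt_pi.2 fun j => hM i j
  rw [hc.self_of_nhds] at hz
  have h2 : DifferentiableAt ℂ (fun w => F (M w)) z :=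
    DifferentiableAt.comp z ((hF _ hz).differentiableAt (hU.mem_nhds hz)) h1
  refine h2.congr_of_eventuallyEq ?_
  filter_upwards [hc, h1.continuousAt.preimage_mem_nhds (hU.mem_nhds hz)] with w hw hwU
  rw [← hw, hFf]
  rw [hw]
  exact hwU

theorem IsHolFun.continuous_comp {f : points T g ℂ → ℂ} (hf : IsHolFun f) {X : Type*}
    [TopologicalSpace X] {c : X → points T g ℂ} (hc : Continuous fun x => mat (c x)) :
    Continuous fun x => f (c x) := by
  rw [continuous_iff_continuousAt]
  intro x
  obtain ⟨U, F, hU, hz, hF, hFf⟩ := hf (c x)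
  have h2 : ContinuousAt (fun y => F (mat (c y))) x :=
    ContinuousAt.comp (f := fun y => mat (c y))
      ((hF _ hz).differentiableAt (hU.mem_nhds hz)).continuousAt hc.continuousAt
  refine h2.congr ?_
  filter_upwards [hc.continuousAt.preimage_mem_nhds (hU.mem_nhds hz)] with y hy
  exact hFf _ hy

/-- The polar decomposition joins every point of `𝔾(ℂ)` to the compact form by a holomorphic
curve. -/
theorem exists_polar_curve (A : points T g ℂ) :
    ∃ c : ℂ → points T g ℂ, c 0 = A ∧ (∀ i j, Differentiable ℂ fun z => mat (c z) i j) ∧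
      ∀ t : ℝ, ∃ U, compactFormToPoints T g U = c (-1 / 2 + t * Complex.I) := by
  -- The curve is `z ↦ A P^z`, with `P^z` defined through an orthonormal eigenbasis of `P`. At `z =
  -- -1/2 + it` it is the unitary factor `A P^{-1/2}` times the unitary matrix `P^{it}`.
  set P := (mat A)ᴴ * mat A with hP
  have hpos : P.PosDef := PosDef.conjTranspose_mul_self _ (mat_injective_mulVec A)
  set V : Matrix (Fin g ⊕ Fin g) (Fin g ⊕ Fin g) ℂ := hpos.1.eigenvectorUnitary.1 with hV
  set l := hpos.1.eigenvalues with hl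
  have hl0 : ∀ i, 0 < l i := hpos.eigenvalues_pos
  have hV1 : V * Vᴴ = 1 := mem_unitaryGroup_iff.1 hpos.1.eigenvectorUnitary.2
  have hV2 : Vᴴ * V = 1 := mem_unitaryGroup_iff'.1 hpos.1.eigenvectorUnitary.2
  have hspec : P = V * diagonal (fun i => (l i : ℂ)) * Vᴴ := hpos.1.spectral_theorem
  let d : ℂ → Matrix (Fin g ⊕ Fin g) (Fin g ⊕ Fin g) ℂ := fun z =>
    diagonal fun i => Complex.exp (z * (Real.log (l i) : ℂ))
  let Q : ℂ → Matrix (Fin g ⊕ Fin g) (Fin g ⊕ Fin g) ℂ := fun z => V * d z * Vᴴ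
  -- `P` preserves the form.
  have hstar : (mat A)ᴴᵀ * form T g ℂ * (mat A)ᴴ = form T g ℂ := by
    have h1 := congrArg conjTranspose (form_mul_transpose_of_preserves (mat_form A))
    simp only [conjTranspose_mul, form_conjTranspose, mul_smul_comm, smul_mul_assoc] at h1
    have h2 := congrArg (fun M => T.sign ℂ • M) h1
    simp only [smul_smul, sign_mul_sign, one_smul] at h2
    rw [Matrix.mul_assoc]
    exact h2
  have hPform : Pᵀ * form T g ℂ * P = form T g ℂ := by
    calc Pᵀ * form T g ℂ * P
        = (mat A)ᵀ * ((mat A)ᴴᵀ * form T g ℂ * (mat A)ᴴ) * mat A := by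
          simp only [hP, transpose_mul, Matrix.mul_assoc]
      _ = form T g ℂ := by rw [hstar, mat_form]
  -- in the eigenbasis, the form pairs the eigenvalues `l` and `l⁻¹`.
  have hVT1 : Vᵀ * Vᴴᵀ = 1 := by rw [← transpose_mul, hV2, transpose_one]
  have hVT2 : Vᴴᵀ * Vᵀ = 1 := by rw [← transpose_mul, hV1, transpose_one]
  have hconj : ∀ v : Fin g ⊕ Fin g → ℂ,
      (V * diagonal v * Vᴴ)ᵀ * form T g ℂ * (V * diagonal v * Vᴴ) = form T g ℂ ↔
        diagonal v * (Vᵀ * form T g ℂ * V) * diagonal v = Vᵀ * form T g ℂ * V := by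
    intro v
    have e1 : (V * diagonal v * Vᴴ)ᵀ * form T g ℂ * (V * diagonal v * Vᴴ) =
        Vᴴᵀ * (diagonal v * (Vᵀ * form T g ℂ * V) * diagonal v) * Vᴴ := by
      simp only [transpose_mul, diagonal_transpose, Matrix.mul_assoc]
    rw [e1]
    constructor
    · intro h
      calc diagonal v * (Vᵀ * form T g ℂ * V) * diagonal v
          = (Vᵀ * Vᴴᵀ) * (diagonal v * (Vᵀ * form T g ℂ * V) * diagonal v) * (Vᴴ * V) := by
            rw [hVT1, hV2, Matrix.one_mul, Matrix.mul_one]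
        _ = Vᵀ * (Vᴴᵀ * (diagonal v * (Vᵀ * form T g ℂ * V) * diagonal v) * Vᴴ) * V := by
            simp only [Matrix.mul_assoc]
        _ = Vᵀ * form T g ℂ * V := by rw [h]
    · intro h
      rw [h]
      calc _ = (Vᴴᵀ * Vᵀ) * form T g ℂ * (V * Vᴴ) := by simp only [Matrix.mul_assoc]
        _ = _ := by rw [hVT2, hV1, Matrix.one_mul, Matrix.mul_one]
  have hpair : ∀ i j, (l i : ℂ) * (Vᵀ * form T g ℂ * V) i j * l j = (Vᵀ * form T g ℂ * V) i j := by
    intro i j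
    rw [hspec] at hPform
    have := congrFun (congrFun ((hconj _).1 hPform) i) j
    rwa [mul_diagonal, diagonal_mul] at this
  -- A nonzero entry `(i, j)` of the form in the eigenbasis forces `l i * l j = 1`, so the
  -- logarithms cancel and the factor `(l i)^z (l j)^z` is `1` for every complex `z`.
  have hQform : ∀ z, (Q z)ᵀ * form T g ℂ * Q z = form T g ℂ := by
    intro z
    refine (hconj _).2 ?_
    ext i j
    rw [mul_diagonal, diagonal_mul]
    by_cases h0 : (Vᵀ * form T g ℂ * V) i j = 0
    · rw [h0]; simp
    · have h1 : l i * l j = 1 := by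
        have h2 : ((l i : ℂ) * l j) * (Vᵀ * form T g ℂ * V) i j =
            1 * (Vᵀ * form T g ℂ * V) i j := by
          rw [one_mul]; conv_rhs => rw [← hpair i j]
          ring
        exact_mod_cast mul_right_cancel₀ h0 h2
      have h2 : Real.log (l i) + Real.log (l j) = 0 := by
        rw [← Real.log_mul (hl0 i).ne' (hl0 j).ne', h1, Real.log_one]
      have h3 : (Real.log (l i) : ℂ) + Real.log (l j) = 0 := by exact_mod_cast h2
      rw [mul_right_comm, ← Complex.exp_add, ← mul_add, h3, mul_zero, Complex.exp_zero, one_mul]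
  refine ⟨fun z => A * mkPoint (Q z) (hQform z), ?_, ?_, ?_⟩
  · apply mat_injective
    have : d 0 = 1 := by simp [d]
    simp [Q, this, hV1]
  · intro i j
    have hd : ∀ k l, Differentiable ℂ fun z => d z k l := by
      intro k l
      by_cases hkl : k = l
      · subst hkl
        simp only [d, diagonal_apply_eq]
        fun_prop
      · simp only [d, diagonal_apply_ne _ hkl]
        fun_prop
    simp only [mat_mul, mat_mkPoint, Q, Matrix.mul_apply]
    fun_prop
  · intro t
    set z : ℂ := -1 / 2 + t * Complex.I with hz
    -- The exponents of `l i` add up to `conj z + 1 + z`, which vanishes on `Re z = -1/2`.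
    have hdd : (d z)ᴴ * diagonal (fun i => (l i : ℂ)) * d z = 1 := by
      simp only [d, diagonal_conjTranspose, diagonal_mul_diagonal]
      rw [← diagonal_one]
      congr 1
      ext i
      have e1 : (l i : ℂ) = Complex.exp (Real.log (l i)) := by
        rw [← Complex.ofReal_exp, Real.exp_log (hl0 i)]
      simp only [Pi.star_apply, RCLike.star_def, ← Complex.exp_conj, map_mul, Complex.conj_ofReal]
      conv_lhs => rw [e1]
      rw [← Complex.exp_add, ← Complex.exp_add, Complex.exp_eq_one_iff]
      refine ⟨0, ?_⟩
      simp only [hz, map_add, map_mul, Complex.conj_I, Complex.conj_ofReal, map_div₀, map_neg,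
        map_one, map_ofNat]
      simp only [Complex.ofReal_log (hl0 i).le]
      push_cast
      ring
    have huni : (mat A * Q z)ᴴ * (mat A * Q z) = 1 := by
      calc (mat A * Q z)ᴴ * (mat A * Q z) = (Q z)ᴴ * P * Q z := by
            simp only [hP, conjTranspose_mul, Matrix.mul_assoc]
        _ = V * (d z)ᴴ * (Vᴴ * V) * diagonal (fun i => (l i : ℂ)) * (Vᴴ * V) * d z * Vᴴ := by
            rw [hspec]
            simp only [Q, conjTranspose_mul, conjTranspose_conjTranspose, Matrix.mul_assoc]
        _ = V * ((d z)ᴴ * diagonal (fun i => (l i : ℂ)) * d z) * Vᴴ := by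
            rw [hV2]; simp only [Matrix.mul_one, Matrix.mul_assoc]
        _ = 1 := by rw [hdd, Matrix.mul_one, hV1]
    refine ⟨⟨⟨mat A * Q z, mem_unitaryGroup_iff'.2 huni⟩, mat_form (A * mkPoint (Q z) (hQform z))⟩,
      mat_injective rfl⟩

/-- Along the polar curve through `A`, `f` becomes an entire function of `z` vanishing on the line
`Re z = -1/2`. The identity theorem makes it vanish at `z = 0`, where the curve is at `A`. -/
theorem IsHolFun.eq_zero_of_compactForm {f : points T g ℂ → ℂ} (hf : IsHolFun f)
    (h0 : ∀ U, f (compactFormToPoints T g U) = 0) (A : points T g ℂ) : f A = 0 := by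
  obtain ⟨c, hc0, hc, hcK⟩ := exists_polar_curve A
  have hd : Differentiable ℂ fun z => f (c z) := fun z =>
    hf.differentiableAt_comp (Filter.Eventually.of_forall fun _ => rfl) fun i j => hc i j z
  have han : AnalyticOnNhd ℂ (fun z => f (c z)) Set.univ := fun z _ => hd.analyticAt z
  have hline : ∀ t : ℝ, f (c (-1 / 2 + t * Complex.I)) = 0 := fun t => by
    obtain ⟨U, hU⟩ := hcK t
    rw [← hU, h0]
  have hfreq : ∃ᶠ z in nhdsWithin (-1 / 2 : ℂ) {-1 / 2}ᶜ, f (c z) = 0 := by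
    have ht : Filter.Tendsto (fun t : ℝ => (-1 / 2 + t * Complex.I : ℂ))
        (nhdsWithin 0 {0}ᶜ) (nhdsWithin (-1 / 2 : ℂ) {-1 / 2}ᶜ) := by
      refine tendsto_nhdsWithin_of_tendsto_nhds_of_eventually_within _ ?_ ?_
      · refine tendsto_nhdsWithin_of_tendsto_nhds ?_
        have : Continuous fun t : ℝ => (-1 / 2 + t * Complex.I : ℂ) := by fun_prop
        simpa using this.tendsto 0
      · filter_upwards [self_mem_nhdsWithin] with t ht
        simpa using ht
    exact ht.frequently (Filter.Frequently.of_forall hline)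
  have := han.eqOn_zero_of_preconnected_of_frequently_eq_zero isPreconnected_univ trivial hfreq
    (Set.mem_univ 0)
  rw [← hc0]
  exact this

end Holomorphic

/-! ### Matrix coefficients of tensor powers. -/

section TensorCoefficients

open Matrix

variable (T : ClassicalType) (g : ℕ)

theorem tensorPowerRep_tprod (k : ℕ) (A : points T g ℂ) (v : Fin k → Fin g ⊕ Fin g → ℂ) :
    tensorPowerRep T g k A (PiTensorProduct.tprod ℂ v) =
      PiTensorProduct.tprod ℂ fun s => mat A *ᵥ v s :=
  PiTensorProduct.map_tprod _ _

/-- Functions on `𝔾(ℂ)` that are polynomial in the matrix entries. -/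
def polynomialFunctions : Submodule ℂ (points T g ℂ → ℂ) where
  carrier := {f | ∃ p : MvPolynomial ((Fin g ⊕ Fin g) × (Fin g ⊕ Fin g)) ℂ,
    ∀ A, MvPolynomial.eval (fun ij => mat A ij.1 ij.2) p = f A}
  add_mem' := fun ⟨p, hp⟩ ⟨q, hq⟩ => ⟨p + q, fun A => by simp [hp, hq]⟩
  zero_mem' := ⟨0, fun A => by simp⟩
  smul_mem' := fun c _ ⟨p, hp⟩ => ⟨MvPolynomial.C c * p, fun A => by simp [hp]⟩

variable {T g}

theorem mem_polynomialFunctions {f : points T g ℂ → ℂ} : f ∈ polynomialFunctions T g ↔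
    ∃ p : MvPolynomial ((Fin g ⊕ Fin g) × (Fin g ⊕ Fin g)) ℂ,
      ∀ A, MvPolynomial.eval (fun ij => mat A ij.1 ij.2) p = f A :=
  Iff.rfl

theorem isHolFun_of_mem_polynomialFunctions {f : points T g ℂ → ℂ}
    (hf : f ∈ polynomialFunctions T g) : IsHolFun f := by
  obtain ⟨p, hp⟩ := mem_polynomialFunctions.1 hf
  rw [← funext hp]
  exact isHolFun_eval p

theorem tensorPowerRep_coefficient_mem (k : ℕ)
    (η : Module.Dual ℂ (⨂[ℂ]^k (Fin g ⊕ Fin g → ℂ))) (w : ⨂[ℂ]^k (Fin g ⊕ Fin g → ℂ)) :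
    (fun A => η (tensorPowerRep T g k A w)) ∈ polynomialFunctions T g := by
  induction w using PiTensorProduct.induction_on with
  | smul_tprod c v =>
    refine mem_polynomialFunctions.2 ⟨MvPolynomial.C c * ∑ r : Fin k → Fin g ⊕ Fin g,
      (∏ s, ∑ j, MvPolynomial.C (v s j) * MvPolynomial.X (r s, j)) *
        MvPolynomial.C (η (PiTensorProduct.tprod ℂ fun s => Pi.single (r s) 1)), fun A => ?_⟩
    have h : ∀ s, mat A *ᵥ v s =
        ∑ i, (mat A *ᵥ v s) i • (Pi.single i 1 : Fin g ⊕ Fin g → ℂ) := fun s => by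
      conv_lhs => rw [← Finset.univ_sum_single (mat A *ᵥ v s)]
      refine Finset.sum_congr rfl fun i _ => ?_
      rw [← Pi.single_smul, smul_eq_mul, mul_one]
    rw [map_smul, map_smul, tensorPowerRep_tprod]
    conv_rhs => rw [show (fun s => mat A *ᵥ v s) = _ from funext h, MultilinearMap.map_sum]
    simp_rw [MultilinearMap.map_smul_univ]
    simp [mulVec, dotProduct, mul_comm]
  | add x y hx hy =>
    simp only [map_add]
    exact add_mem hx hy

/-- Take for `w` a tensor of standard basis vectors and for `η` a product of coordinate functionals.
-/
theorem exists_tensorPowerRep_coefficient {k : ℕ} (a : Fin k → (Fin g ⊕ Fin g) × (Fin g ⊕ Fin g)) :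
    ∃ (η : Module.Dual ℂ (⨂[ℂ]^k (Fin g ⊕ Fin g → ℂ))) (w : ⨂[ℂ]^k (Fin g ⊕ Fin g → ℂ)),
      ∀ A : points T g ℂ, η (tensorPowerRep T g k A w) = ∏ s, mat A (a s).1 (a s).2 := by
  refine ⟨PiTensorProduct.lift ((MultilinearMap.mkPiAlgebra ℂ (Fin k) ℂ).compLinearMap
    fun s => LinearMap.proj (a s).1), PiTensorProduct.tprod ℂ fun s => Pi.single (a s).2 1,
    fun A => ?_⟩
  rw [tensorPowerRep_tprod, PiTensorProduct.lift.tprod]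
  simp

theorem tensorPowerRep_isHolomorphicRep (k : ℕ) : IsHolomorphicRep (tensorPowerRep T g k) :=
  fun w η => isHolFun_of_mem_polynomialFunctions (tensorPowerRep_coefficient_mem k η w)

end TensorCoefficients

/-! ### Complete reducibility, finite degree and polynomial coefficients. -/

section HolomorphicRep

open Matrix MeasureTheory

variable {T : ClassicalType} {g : ℕ} {E W : Type*} [AddCommGroup E] [Module ℂ E]
  [AddCommGroup W] [Module ℂ W]

/-- Tested on a functional, the failure of equivariance is a holomorphic function of `A` that
vanishes on the compact form. -/
theorem equivariant_of_compactForm {R : Representation ℂ (points T g ℂ) E}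
    {S : Representation ℂ (points T g ℂ) W} (hR : IsHolomorphicRep R) (hS : IsHolomorphicRep S)
    (Φ : E →ₗ[ℂ] W)
    (hΦ : ∀ U v, Φ (R (compactFormToPoints T g U) v) = S (compactFormToPoints T g U) (Φ v))
    (A : points T g ℂ) (v : E) : Φ (R A v) = S A (Φ v) := by
  refine eq_of_forall_dual fun η => ?_
  rw [← sub_eq_zero]
  refine IsHolFun.eq_zero_of_compactForm (f := fun A => η (Φ (R A v)) - η (S A (Φ v)))
    (IsHolFun.sub (hR v (η ∘ₗ Φ)) (hS (Φ v) η)) (fun U => ?_) A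
  simp only [hΦ, sub_self]

/-- The restriction of a representation of `𝔾(ℂ)` to the compact form. -/
def compactRestrict (R : Representation ℂ (points T g ℂ) E) :
    Representation ℂ (compactForm T g) E :=
  R.comp (compactFormToPoints T g)

theorem weaklyContinuous_compactRestrict {R : Representation ℂ (points T g ℂ) E}
    (hR : IsHolomorphicRep R) (v : E) : WeaklyContinuous fun U => compactRestrict R U v :=
  fun η => IsHolFun.continuous_comp (hR v η) (continuous_mat_compactFormToPoints T g)

theorem exists_haar_probability (K : Type*) [TopologicalSpace K] [CompactSpace K] [Group K]
    [IsTopologicalGroup K] [MeasurableSpace K] [BorelSpace K] :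
    ∃ μ : Measure K, IsProbabilityMeasure μ ∧ μ.IsMulLeftInvariant ∧ μ.IsOpenPosMeasure :=
  ⟨Measure.haarMeasure ⊤, ⟨Measure.haarMeasure_self⟩, inferInstance, inferInstance⟩

/-- Complete reducibility of holomorphic representations of `𝔾(ℂ)`. -/
theorem exists_equivariant_projection [Module.Finite ℂ E]
    {R : Representation ℂ (points T g ℂ) E} (hR : IsHolomorphicRep R) (F : Submodule ℂ E)
    (hF : ∀ A, ∀ v ∈ F, R A v ∈ F) :
    ∃ π : E →ₗ[ℂ] E, (∀ v, π v ∈ F) ∧ (∀ v ∈ F, π v = v) ∧ ∀ A v, π (R A v) = R A (π v) := by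
  let _ : MeasurableSpace (compactForm T g) := borel _
  have : BorelSpace (compactForm T g) := ⟨rfl⟩
  obtain ⟨μ, _, _, _⟩ := exists_haar_probability (compactForm T g)
  obtain ⟨π, h1, h2, h3⟩ := exists_equivariant_projection_of_compact μ (compactRestrict R)
    (weaklyContinuous_compactRestrict hR) F fun U => hF _
  exact ⟨π, h1, h2, equivariant_of_compactForm hR hR π h3⟩

/-- The equivariant maps from `E` to the `V^{⊗ i}` with `i ≤ k` separate the points of `E`. -/
def SeparatedInDegree (R : Representation ℂ (points T g ℂ) E) (k : ℕ) : Prop :=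
  ∀ v : E, (∀ i ≤ k, ∀ φ : E →ₗ[ℂ] ⨂[ℂ]^i (Fin g ⊕ Fin g → ℂ),
    (∀ A x, φ (R A x) = tensorPowerRep T g i A (φ x)) → φ v = 0) → v = 0

/-- With `J` the form and `ε` its sign, unitarity and preservation of `J` give `U* = U⁻¹ = εJUᵀJ`.
This is the star condition required for Stone–Weierstrass. -/
theorem star_entry_of_compactForm (U : compactForm T g) (i j : Fin g ⊕ Fin g) :
    star (U.1.1 i j) =
      ∑ k, ∑ l, (T.sign ℂ * form T g ℂ j k * form T g ℂ l i) * U.1.1 l k := by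
  have h1 : U.1.1 * U.1.1ᴴ = 1 := mem_unitaryGroup_iff.1 U.1.2
  have h2 : U.1.1ᵀ * form T g ℂ * U.1.1 = form T g ℂ := U.2
  have h3 : U.1.1ᴴ = (T.sign ℂ • form T g ℂ) * (U.1.1ᵀ * form T g ℂ) := by
    calc U.1.1ᴴ = (T.sign ℂ • form T g ℂ) * form T g ℂ * U.1.1ᴴ := by
          rw [sign_smul_form_mul_form, Matrix.one_mul]
      _ = (T.sign ℂ • form T g ℂ) * (U.1.1ᵀ * form T g ℂ * U.1.1) * U.1.1ᴴ := by rw [h2]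
      _ = (T.sign ℂ • form T g ℂ) * (U.1.1ᵀ * form T g ℂ) * (U.1.1 * U.1.1ᴴ) := by
          simp only [Matrix.mul_assoc]
      _ = _ := by rw [h1, Matrix.mul_one]
  have h4 : star (U.1.1 i j) = U.1.1ᴴ j i := rfl
  rw [h4, h3]
  simp only [Matrix.mul_apply, Matrix.smul_apply, smul_eq_mul, transpose_apply, Finset.mul_sum]
  refine Finset.sum_congr rfl fun k _ => Finset.sum_congr rfl fun l _ => ?_
  ring

/-- A holomorphic representation is separated by equivariant maps to tensor powers: the matrix
coefficients of tensor powers are dense in the continuous functions on the compact form. -/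
theorem eq_zero_of_forall_equivariant [Module.Finite ℂ E]
    {R : Representation ℂ (points T g ℂ) E} (hR : IsHolomorphicRep R) (v : E)
    (hv : ∀ (i : ℕ) (φ : E →ₗ[ℂ] ⨂[ℂ]^i (Fin g ⊕ Fin g → ℂ)),
      (∀ A x, φ (R A x) = tensorPowerRep T g i A (φ x)) → φ v = 0) : v = 0 := by
  let _ : MeasurableSpace (compactForm T g) := borel _
  have : BorelSpace (compactForm T g) := ⟨rfl⟩
  obtain ⟨μ, _, _, _⟩ := exists_haar_probability (compactForm T g)
  refine eq_of_forall_dual fun ψ => ?_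
  let F : C(compactForm T g, ℂ) := ⟨fun U => ψ (compactRestrict R U⁻¹ v),
    (weaklyContinuous_compactRestrict hR v ψ).comp continuous_inv⟩
  let e : (Fin g ⊕ Fin g) × (Fin g ⊕ Fin g) → C(compactForm T g, ℂ) := fun ij =>
    ⟨fun U => U.1.1 ij.1 ij.2,
      (continuous_mat_compactFormToPoints T g).matrix_elem ij.1 ij.2⟩
  have hF : F = 0 := by
    refine eq_zero_of_forall_integral_monomial μ e (fun x y hxy => ?_) (fun ij => ?_) F
      (fun k a => ?_)
    · exact Subtype.ext (Subtype.ext (Matrix.ext fun i j => hxy (i, j)))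
    · have : star (e ij) = ∑ k, ∑ l,
          (T.sign ℂ * form T g ℂ ij.2 k * form T g ℂ l ij.1) • e (l, k) := by
        ext U
        simp only [ContinuousMap.sum_apply, ContinuousMap.smul_apply, smul_eq_mul]
        exact star_entry_of_compactForm U ij.1 ij.2
      rw [this]
      exact Submodule.sum_mem _ fun k _ => Submodule.sum_mem _ fun l _ =>
        Submodule.smul_mem _ _ (Submodule.subset_span ⟨(l, k), rfl⟩)
    · obtain ⟨η, w, hw⟩ := exists_tensorPowerRep_coefficient (T := T) a
      -- The rank-one map `x ↦ ψ(x) w` is averaged. The resulting `η (Φ v)` is the integral of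
      -- `ψ(U⁻¹v) η(Uw)`, that is, of `F` times the given monomial, and `Φ v = 0` by hypothesis.
      obtain ⟨Φ, hΦ, hint⟩ := exists_intertwiner_average μ (compactRestrict R)
        (compactRestrict (tensorPowerRep T g k)) (weaklyContinuous_compactRestrict hR)
        (weaklyContinuous_compactRestrict (tensorPowerRep_isHolomorphicRep k)) (ψ.smulRight w)
      have h0 := hint v η
      rw [hv k Φ (equivariant_of_compactForm hR (tensorPowerRep_isHolomorphicRep k) Φ hΦ),
        map_zero] at h0
      rw [h0]
      refine integral_congr_ae (Filter.Eventually.of_forall fun U => ?_)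
      have h1 := hw (compactFormToPoints T g U)
      simp only [LinearMap.smulRight_apply, map_smul, smul_eq_mul]
      rw [mul_comm]
      congr 1
      exact h1.symm
  have := DFunLike.congr_fun hF 1
  simpa [F, compactRestrict] using this

/-- The common kernels `N k` of the equivariant maps to `V^{⊗ i}`, `i ≤ k`, decrease with `k`, so
they stabilise. Their intersection is zero. -/
theorem exists_separatedInDegree [Module.Finite ℂ E]
    {R : Representation ℂ (points T g ℂ) E} (hR : IsHolomorphicRep R) :
    ∃ k, SeparatedInDegree R k := by
  let N : ℕ → Submodule ℂ E := fun k =>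
    ⨅ (i : ℕ) (_ : i ≤ k) (φ : E →ₗ[ℂ] ⨂[ℂ]^i (Fin g ⊕ Fin g → ℂ))
      (_ : ∀ A x, φ (R A x) = tensorPowerRep T g i A (φ x)), LinearMap.ker φ
  have hN : ∀ k v, v ∈ N k ↔ ∀ i ≤ k, ∀ φ : E →ₗ[ℂ] ⨂[ℂ]^i (Fin g ⊕ Fin g → ℂ),
      (∀ A x, φ (R A x) = tensorPowerRep T g i A (φ x)) → φ v = 0 := by
    intro k v
    simp only [N, Submodule.mem_iInf, LinearMap.mem_ker]
  let f : ℕ →o (Submodule ℂ E)ᵒᵈ := ⟨fun k => OrderDual.toDual (N k), fun a b hab v hv =>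
    (hN a v).2 fun i hi => (hN b v).1 hv i (hi.trans hab)⟩
  obtain ⟨n, hn⟩ := IsArtinian.monotone_stabilizes f
  refine ⟨n, fun v hv => eq_zero_of_forall_equivariant hR v fun i φ hφ => ?_⟩
  have h1 : v ∈ N n := (hN n v).2 hv
  have h2 : N n = N (max n i) := hn (max n i) (le_max_left _ _)
  rw [h2] at h1
  exact (hN _ v).1 h1 i (le_max_right _ _) φ hφ

theorem SeparatedInDegree.exists_injective [Module.Finite ℂ E]
    {R : Representation ℂ (points T g ℂ) E} {k : ℕ} (h : SeparatedInDegree R k) :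
    ∃ (m : ℕ) (Φ : E →ₗ[ℂ] ((i : Fin (k + 1)) → Fin m → ⨂[ℂ]^(i : ℕ) (Fin g ⊕ Fin g → ℂ))),
      Function.Injective Φ ∧ ∀ (A : points T g ℂ) (x : E) (i : Fin (k + 1)) (j : Fin m),
        Φ (R A x) i j = tensorPowerRep T g i A (Φ x i j) := by
  let H : (i : ℕ) → Submodule ℂ (E →ₗ[ℂ] ⨂[ℂ]^i (Fin g ⊕ Fin g → ℂ)) := fun i =>
    { carrier := {φ | ∀ A x, φ (R A x) = tensorPowerRep T g i A (φ x)}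
      add_mem' := fun {a b} ha hb A x => by
        rw [LinearMap.add_apply, LinearMap.add_apply, ha, hb, map_add]
      zero_mem' := fun A x => by simp
      smul_mem' := fun c φ hφ A x => by
        rw [LinearMap.smul_apply, LinearMap.smul_apply, hφ, map_smul] }
  have hfin : ∀ i, ∃ (n : ℕ) (s : Fin n → H i), Submodule.span ℂ (Set.range s) = ⊤ :=
    fun i => Module.Finite.exists_fin
  choose n s hs using hfin
  obtain ⟨m, hm⟩ : ∃ m, ∀ i : Fin (k + 1), n i ≤ m :=
    ⟨Finset.univ.sup fun i : Fin (k + 1) => n i,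
      fun i => Finset.le_sup (f := fun i : Fin (k + 1) => n i) (Finset.mem_univ i)⟩
  -- The number of generators of `H i` varies with `i`, while `m` is common to all degrees; the
  -- lists are padded with zero maps.
  let ψ : (i : Fin (k + 1)) → Fin m → H i := fun i j =>
    if hj : (j : ℕ) < n i then s i ⟨j, hj⟩ else 0
  refine ⟨m, LinearMap.pi fun i => LinearMap.pi fun j => (ψ i j).1, ?_,
    fun A x i j => (ψ i j).2 A x⟩
  rw [injective_iff_map_eq_zero]
  intro v hv
  refine h v fun i hi φ hφ => ?_
  have hsv : ∀ j, (s i j).1 v = 0 := by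
    intro j
    have := congrFun (congrFun hv ⟨i, Nat.lt_succ_of_le hi⟩)
      ⟨j, j.2.trans_le (hm ⟨i, Nat.lt_succ_of_le hi⟩)⟩
    simpa [ψ] using this
  have hmem : (⟨φ, hφ⟩ : H i) ∈ Submodule.span ℂ (Set.range (s i)) := by rw [hs]; trivial
  have hle : Submodule.span ℂ (Set.range (s i)) ≤
      LinearMap.ker ((LinearMap.applyₗ v).comp (H i).subtype) := by
    rw [Submodule.span_le]
    rintro _ ⟨j, rfl⟩
    exact hsv j
  exact hle hmem

theorem separatedInDegree_of_injective {R : Representation ℂ (points T g ℂ) E} {k m : ℕ}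
    (Φ : E →ₗ[ℂ] ((i : Fin (k + 1)) → Fin m → ⨂[ℂ]^(i : ℕ) (Fin g ⊕ Fin g → ℂ)))
    (hinj : Function.Injective Φ)
    (hΦ : ∀ (A : points T g ℂ) (x : E) (i : Fin (k + 1)) (j : Fin m),
      Φ (R A x) i j = tensorPowerRep T g i A (Φ x i j)) : SeparatedInDegree R k := by
  intro v hv
  rw [injective_iff_map_eq_zero] at hinj
  refine hinj v ?_
  ext1 i
  ext1 j
  exact hv i (Nat.lt_succ_iff.1 i.2) (LinearMap.proj j ∘ₗ LinearMap.proj i ∘ₗ Φ)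
    fun A x => hΦ A x i j

theorem isArithmeticRepOfDegreeLE_iff {Γ : Subgroup (points T g ℝ)} {r : Representation ℂ Γ E}
    {k : ℕ} : IsArithmeticRepOfDegreeLE r k ↔ Module.Finite ℂ E ∧
      ∃ R : Representation ℂ (points T g ℂ) E, IsHolomorphicExtension r R ∧
        SeparatedInDegree R k := by
  constructor
  · rintro ⟨hfin, R, hR, m, Φ, hinj, hΦ⟩
    exact ⟨hfin, R, hR, separatedInDegree_of_injective Φ hinj hΦ⟩
  · rintro ⟨hfin, R, hR, hsep⟩
    exact ⟨hfin, R, hR, hsep.exists_injective⟩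

/-- The matrix coefficients of a holomorphic representation are polynomial. -/
theorem IsHolomorphicRep.coefficient_mem [Module.Finite ℂ E]
    {R : Representation ℂ (points T g ℂ) E} (hR : IsHolomorphicRep R) (v : E)
    (ψ : Module.Dual ℂ E) : (fun A => ψ (R A v)) ∈ polynomialFunctions T g := by
  -- `P` contains `η ∘ φ` for every equivariant `φ` to a tensor power. Such functionals separate
  -- points, so `P` has zero coannihilator and is the whole dual.
  let P : Subspace ℂ (Module.Dual ℂ E) :=
    { carrier := {ψ | ∀ v, (fun A => ψ (R A v)) ∈ polynomialFunctions T g}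
      add_mem' := fun ha hb v => add_mem (ha v) (hb v)
      zero_mem' := fun v => zero_mem _
      smul_mem' := fun c _ ha v => Submodule.smul_mem _ c (ha v) }
  have hP : P.dualCoannihilator = ⊥ := by
    rw [eq_bot_iff]
    intro x hx
    rw [Submodule.mem_dualCoannihilator] at hx
    refine eq_zero_of_forall_equivariant hR x fun i φ hφ => eq_of_forall_dual fun η => ?_
    rw [map_zero]
    refine hx (η ∘ₗ φ) fun w => ?_
    simp only [LinearMap.comp_apply, hφ]
    exact tensorPowerRep_coefficient_mem i η (φ w)
  have htop : P = ⊤ := by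
    rw [← Subspace.dualCoannihilator_dualAnnihilator_eq (W := P), hP,
      Submodule.dualAnnihilator_bot]
  have : ψ ∈ P := by rw [htop]; trivial
  exact this v

end HolomorphicRep

/-! ### Generation of `𝔾(ℂ)` by transvections or reflections. -/

section Generation

open Matrix

variable {T : ClassicalType} {g : ℕ}

/-- The bilinear form preserved by `𝔾(ℂ)`. -/
noncomputable def bil (T : ClassicalType) (g : ℕ) : LinearMap.BilinForm ℂ (Fin g ⊕ Fin g → ℂ) :=
  Matrix.toBilin' (form T g ℂ)

theorem bil_apply (x y : Fin g ⊕ Fin g → ℂ) : bil T g x y = x ⬝ᵥ form T g ℂ *ᵥ y :=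
  Matrix.toBilin'_apply' _ _ _

theorem bil_swap (x y : Fin g ⊕ Fin g → ℂ) : bil T g y x = T.sign ℂ * bil T g x y := by
  rw [bil_apply, bil_apply, dotProduct_mulVec, dotProduct_comm, ← mulVec_transpose, form_transpose,
    smul_mulVec, dotProduct_smul, smul_eq_mul]

theorem bil_mat (A : points T g ℂ) (x y : Fin g ⊕ Fin g → ℂ) :
    bil T g (mat A *ᵥ x) (mat A *ᵥ y) = bil T g x y := by
  have h := Matrix.toBilin'_comp (form T g ℂ) (mat A) (mat A)
  rw [mat_form] at h
  exact LinearMap.congr_fun (LinearMap.congr_fun h x) y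

/-- The matrix of `x ↦ x + t B(u, x) u`. -/
def transvectionMatrix (T : ClassicalType) {g : ℕ} (u : Fin g ⊕ Fin g → ℂ) (t : ℂ) :
    Matrix (Fin g ⊕ Fin g) (Fin g ⊕ Fin g) ℂ :=
  1 + t • vecMulVec u (u ᵥ* form T g ℂ)

theorem transvectionMatrix_mulVec (u : Fin g ⊕ Fin g → ℂ) (t : ℂ) (x : Fin g ⊕ Fin g → ℂ) :
    transvectionMatrix T u t *ᵥ x = x + (t * bil T g u x) • u := by
  rw [transvectionMatrix, add_mulVec, one_mulVec, smul_mulVec, vecMulVec_mulVec, bil_apply,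
    dotProduct_mulVec, mul_smul, op_smul_eq_smul]

/-- The map changes `B(x, y)` by `B(u, x) B(u, y)` times the left side of `h`. In the symplectic
case `h` always holds; in the orthogonal case it means `t = 0` or `t B(u, u) = -2`. -/
theorem transvectionMatrix_preserves {u : Fin g ⊕ Fin g → ℂ} {t : ℂ}
    (h : t * (1 + T.sign ℂ) + t * t * bil T g u u = 0) :
    (transvectionMatrix T u t)ᵀ * form T g ℂ * transvectionMatrix T u t = form T g ℂ := by
  apply (Matrix.toBilin' (R₁ := ℂ) (n := Fin g ⊕ Fin g)).injective
  rw [← Matrix.toBilin'_comp]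
  refine LinearMap.ext fun x => LinearMap.ext fun y => ?_
  change bil T g (transvectionMatrix T u t *ᵥ x) (transvectionMatrix T u t *ᵥ y) = bil T g x y
  simp only [transvectionMatrix_mulVec, map_add, map_smul, LinearMap.add_apply,
    LinearMap.smul_apply, smul_eq_mul]
  rw [bil_swap u x]
  linear_combination (bil T g u x * bil T g u y) * h

/-- A transvection (symplectic case) or reflection (orthogonal case). -/
def transvection (u : Fin g ⊕ Fin g → ℂ) (t : ℂ)
    (h : t * (1 + T.sign ℂ) + t * t * bil T g u u = 0) : points T g ℂ :=
  mkPoint (transvectionMatrix T u t) (transvectionMatrix_preserves h)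

theorem mat_transvection_mulVec (u : Fin g ⊕ Fin g → ℂ) (t : ℂ)
    (h : t * (1 + T.sign ℂ) + t * t * bil T g u u = 0) (x : Fin g ⊕ Fin g → ℂ) :
    mat (transvection u t h) *ᵥ x = x + (t * bil T g u x) • u :=
  transvectionMatrix_mulVec u t x

theorem mat_mul_mulVec (A B : points T g ℂ) (x : Fin g ⊕ Fin g → ℂ) :
    mat (A * B) *ᵥ x = mat A *ᵥ mat B *ᵥ x := by
  rw [mat_mul, mulVec_mulVec]

theorem eq_one_of_fixes_basis {ι : Type*} (b : Module.Basis ι ℂ (Fin g ⊕ Fin g → ℂ))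
    (A : points T g ℂ) (h : ∀ i, mat A *ᵥ b i = b i) : A = 1 := by
  apply mat_injective
  have : Matrix.toLin' (mat A) = Matrix.toLin' 1 := by
    refine b.ext fun i => ?_
    simp [h i]
  exact Matrix.toLin'.injective this

/-- Submonoids suffice, and they suit the application: the elements mapping a subspace into itself
visibly form a submonoid. -/
theorem eq_top_of_forall_exists_mul_eq_one {G : Type*} [Group G] (S : Submonoid G)
    (h : ∀ A, ∃ B ∈ S, B * A = 1) : S = ⊤ := by
  rw [eq_top_iff]
  intro A _
  obtain ⟨B, hB, hBA⟩ := h A⁻¹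
  rw [mul_inv_eq_one] at hBA
  exact hBA ▸ hB

/-- Cartan–Dieudonné: along an orthogonal basis of anisotropic vectors, `A` is corrected one basis
vector at a time. The reflections used fix the basis vectors already treated, which are orthogonal
to both the current vector and its image. -/
theorem orthogonal_generation (S : Submonoid (points .orthogonal g ℂ))
    (hS : ∀ u t h, transvection (T := .orthogonal) (g := g) u t h ∈ S) : S = ⊤ := by
  let B := bil .orthogonal g
  have hsym : ∀ x y, B y x = B x y := fun x y => by
    rw [bil_swap x y]; simp [ClassicalType.sign, B]
  have hinv : IsUnit (form .orthogonal g ℂ).det :=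
    isUnit_det_of_left_inverse (sign_smul_form_mul_form _ _ _)
  have : Invertible (2 : ℂ) := invertibleOfNonzero two_ne_zero
  obtain ⟨v, hv⟩ := LinearMap.BilinForm.exists_orthogonal_basis (B := B) ⟨fun x y => hsym y x⟩
  have hv0 : ∀ i, B (v i) (v i) ≠ 0 :=
    LinearMap.BilinForm.iIsOrtho.not_isOrtho_basis_self_of_nondegenerate hv
      (LinearMap.BilinForm.nondegenerate_toBilin'_of_det_ne_zero' _ hinv.ne_zero)
  have hrefl : ∀ u, B u u ≠ 0 → ∃ h ∈ S, ∀ x, mat h *ᵥ x = x + (-2 / B u u * B u x) • u := by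
    intro u hu
    refine ⟨transvection u (-2 / B u u) ?_, hS _ _ _, mat_transvection_mulVec _ _ _⟩
    change -2 / B u u * (1 + 1) + -2 / B u u * (-2 / B u u) * B u u = 0
    field_simp
    ring
  have hmove : ∀ x y, B x x = B y y → B y y ≠ 0 → ∃ h ∈ S, mat h *ᵥ x = y ∧
      ∀ w, B x w = 0 → B y w = 0 → mat h *ᵥ w = w := by
    intro x y hxy hy
    -- If `x - y` is anisotropic, its reflection sends `x` to `y`. Otherwise `x + y` is anisotropic
    -- by the parallelogram identity; its reflection sends `x` to `-y`, and the reflection in `y`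
    -- finishes.
    by_cases h1 : B (x - y) (x - y) = 0
    · have h2 : B (x + y) (x + y) = 4 * B y y := by
        simp only [map_add, map_sub, LinearMap.add_apply, LinearMap.sub_apply] at h1 ⊢
        linear_combination 2 * hxy - h1
      have h3 : B (x + y) (x + y) ≠ 0 := by rw [h2]; simpa using hy
      have h4 : B (x + y) x = 2 * B y y := by
        simp only [map_add, map_sub, LinearMap.add_apply, LinearMap.sub_apply] at h1 ⊢
        have := hsym x y
        linear_combination (3 / 2) * hxy - h1 / 2 + this / 2
      obtain ⟨a, ha, hax⟩ := hrefl _ h3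
      obtain ⟨b, hb, hbx⟩ := hrefl _ hy
      refine ⟨b * a, S.mul_mem hb ha, ?_, fun w hx hy => ?_⟩
      · rw [mat_mul_mulVec, hax, h2, h4,
          show -2 / (4 * B y y) * (2 * B y y) = -1 by field_simp; norm_num, hbx,
          show x + (-1 : ℂ) • (x + y) = -y by module, map_neg,
          show -2 / B y y * -B y y = 2 by field_simp]
        module
      · have hxyw : B (x + y) w = 0 := by rw [map_add, LinearMap.add_apply, hx, hy, add_zero]
        rw [mat_mul_mulVec, hax, hxyw, mul_zero, zero_smul, add_zero, hbx, hy, mul_zero,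
          zero_smul, add_zero]
    · obtain ⟨a, ha, hax⟩ := hrefl _ h1
      refine ⟨a, ha, ?_, fun w hx hy => ?_⟩
      · have h5 : B (x - y) (x - y) = 2 * B (x - y) x := by
          simp only [map_sub, LinearMap.sub_apply]
          linear_combination -hxy + hsym x y
        rw [hax, show -2 / B (x - y) (x - y) * B (x - y) x = -1 by
          rw [h5] at h1 ⊢
          have : B (x - y) x ≠ 0 := right_ne_zero_of_mul h1
          field_simp]
        module
      · have hxyw : B (x - y) w = 0 := by rw [map_sub, LinearMap.sub_apply, hx, hy, sub_zero]
        rw [hax, hxyw, mul_zero, zero_smul, add_zero]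
  refine eq_top_of_forall_exists_mul_eq_one S fun A => ?_
  have key : ∀ s : Finset (Fin (Module.finrank ℂ (Fin g ⊕ Fin g → ℂ))),
      ∃ C ∈ S, ∀ i ∈ s, mat (C * A) *ᵥ v i = v i := by
    intro s
    induction s using Finset.induction_on with
    | empty => exact ⟨1, S.one_mem, by simp⟩
    | insert k s hk ih =>
      obtain ⟨C, hC, hCA⟩ := ih
      obtain ⟨h, hh, hx, hw⟩ := hmove (mat (C * A) *ᵥ v k) (v k) (bil_mat _ _ _) (hv0 k)
      refine ⟨h * C, S.mul_mem hh hC, fun i hi => ?_⟩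
      rw [mul_assoc, mat_mul_mulVec]
      rcases Finset.mem_insert.1 hi with rfl | hi
      · exact hx
      · have hki : B (v k) (v i) = 0 := hv (by rintro rfl; exact hk hi)
        rw [hCA i hi]
        refine hw _ ?_ hki
        rw [← hCA i hi]
        exact (bil_mat _ _ _).trans hki
  obtain ⟨C, hC, hCA⟩ := key Finset.univ
  exact ⟨C, hC, eq_one_of_fixes_basis v _ fun i => hCA i (Finset.mem_univ i)⟩

/-- `A` is corrected one hyperbolic pair at a time. A transvection along `x - y` moves `x` to `y`
when `B x y ≠ 0`; otherwise an intermediate vector is used. A vector is undisturbed when it pairs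
equally with all the vectors in the chain. -/
theorem symplectic_generation (S : Submonoid (points .symplectic g ℂ))
    (hS : ∀ u t h, transvection (T := .symplectic) (g := g) u t h ∈ S) : S = ⊤ := by
  let B := bil .symplectic g
  have hskew : ∀ x y, B y x = -B x y := fun x y => by
    rw [bil_swap x y]; simp [ClassicalType.sign, B]
  have halt : ∀ x, B x x = 0 := fun x => self_eq_neg.1 (hskew x x)
  let e : Fin g → Fin g ⊕ Fin g → ℂ := fun i => Pi.single (Sum.inl i) 1
  let f : Fin g → Fin g ⊕ Fin g → ℂ := fun i => Pi.single (Sum.inr i) 1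
  have hef : ∀ i j, B (e i) (f j) = if i = j then -1 else 0 := fun i j => by
    split_ifs with h <;> simp [B, e, f, bil, form, Matrix.J, h]
  have hee : ∀ i j, B (e i) (e j) = 0 := fun i j => by
    simp [B, e, bil, form, Matrix.J]
  have hff : ∀ i j, B (f i) (f j) = 0 := fun i j => by
    simp [B, f, bil, form, Matrix.J]
  have hfe : ∀ i j, B (f i) (e j) = if i = j then 1 else 0 := fun i j => by
    rw [hskew, hef]
    by_cases h : i = j
    · rw [if_pos h, if_pos h.symm, neg_neg]
    · rw [if_neg h, if_neg (Ne.symm h), neg_zero]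
  have hmove : ∀ x y, B x y ≠ 0 → ∃ h ∈ S, mat h *ᵥ x = y ∧
      ∀ w, B (x - y) w = 0 → mat h *ᵥ w = w := by
    intro x y hxy
    refine ⟨transvection (x - y) (-1 / B x y) ?_, hS _ _ _, ?_, fun w hw => ?_⟩
    · change _ * (1 + -1) + _ * B (x - y) (x - y) = 0
      rw [halt]; ring
    · rw [mat_transvection_mulVec]
      have : B (x - y) x = B x y := by
        rw [map_sub, LinearMap.sub_apply, halt, hskew x y]; ring
      change x + (-1 / B x y * B (x - y) x) • (x - y) = y
      rw [this, div_mul_cancel₀ _ hxy]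
      module
    · rw [mat_transvection_mulVec]
      change w + (_ * B (x - y) w) • (x - y) = w
      rw [hw, mul_zero, zero_smul, add_zero]
  have hmove2 : ∀ x z y, B x z ≠ 0 → B z y ≠ 0 → ∃ h ∈ S, mat h *ᵥ x = y ∧
      ∀ w, B x w = B y w → B z w = B y w → mat h *ᵥ w = w := by
    intro x z y hxz hzy
    obtain ⟨a, ha, hax, haw⟩ := hmove x z hxz
    obtain ⟨b, hb, hbx, hbw⟩ := hmove z y hzy
    refine ⟨b * a, S.mul_mem hb ha, ?_, fun w h1 h2 => ?_⟩
    · rw [mat_mul_mulVec, hax, hbx]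
    · rw [mat_mul_mulVec, haw w, hbw w]
      · rw [map_sub, LinearMap.sub_apply, h2, sub_self]
      · rw [map_sub, LinearMap.sub_apply, h1, h2, sub_self]
  have hmove1 : ∀ x y, B x y ≠ 0 → ∃ h ∈ S, mat h *ᵥ x = y ∧
      ∀ w, B x w = B y w → mat h *ᵥ w = w := by
    intro x y hxy
    obtain ⟨a, ha, hax, haw⟩ := hmove x y hxy
    exact ⟨a, ha, hax, fun w hw => haw w (by rw [map_sub, LinearMap.sub_apply, hw, sub_self])⟩
  refine eq_top_of_forall_exists_mul_eq_one S fun A => ?_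
  have key : ∀ s : Finset (Fin g), ∃ C ∈ S, ∀ i ∈ s,
      mat (C * A) *ᵥ e i = e i ∧ mat (C * A) *ᵥ f i = f i := by
    intro s
    induction s using Finset.induction_on with
    | empty => exact ⟨1, S.one_mem, by simp⟩
    | insert k s hk ih =>
      obtain ⟨C, hC, hCA⟩ := ih
      have hne : ∀ i ∈ s, k ≠ i := by rintro i hi rfl; exact hk hi
      have hBe : ∀ D : points .symplectic g ℂ, (∀ i ∈ s, mat D *ᵥ e i = e i) →
          ∀ x, ∀ i ∈ s, B (mat D *ᵥ x) (e i) = B x (e i) := by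
        intro D hD x i hi
        conv_lhs => rw [← hD i hi]
        exact bil_mat _ _ _
      have hBf : ∀ D : points .symplectic g ℂ, (∀ i ∈ s, mat D *ᵥ f i = f i) →
          ∀ x, ∀ i ∈ s, B (mat D *ᵥ x) (f i) = B x (f i) := by
        intro D hD x i hi
        conv_lhs => rw [← hD i hi]
        exact bil_mat _ _ _
      have hBe₁ := hBe _ fun i hi => (hCA i hi).1
      have hBf₁ := hBf _ fun i hi => (hCA i hi).2
      set x := mat (C * A) *ᵥ e k with hx
      set z := mat (C * A) *ᵥ f k with hz
      have hxz : B x z = -1 := (bil_mat _ _ _).trans (by simpa using hef k k)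
      have hkk : B (f k) (e k) = 1 := by simpa using hfe k k
      have hkk' : B (e k) (f k) = -1 := by simpa using hef k k
      obtain ⟨h, hh, hhx, hhw⟩ : ∃ h ∈ S, mat h *ᵥ x = e k ∧
          ∀ i ∈ s, mat h *ᵥ e i = e i ∧ mat h *ᵥ f i = f i := by
        have e1 : ∀ i ∈ s, B x (e i) = B (e k) (e i) := fun i hi => hBe₁ _ i hi
        have e2 : ∀ i ∈ s, B x (f i) = B (e k) (f i) := fun i hi => hBf₁ _ i hi
        have e3 : ∀ i ∈ s, B (f k) (e i) = B (e k) (e i) := fun i hi => by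
          rw [hfe, hee, if_neg (hne i hi)]
        have e4 : ∀ i ∈ s, B (f k) (f i) = B (e k) (f i) := fun i hi => by
          rw [hff, hef, if_neg (hne i hi)]
        have e5 : ∀ i ∈ s, B z (e i) = B (e k) (e i) := fun i hi =>
          (hBe₁ _ i hi).trans (e3 i hi)
        have e6 : ∀ i ∈ s, B z (f i) = B (e k) (f i) := fun i hi =>
          (hBf₁ _ i hi).trans (e4 i hi)
        -- The intermediate vector is `f k`, or the image `z` of `f k`, or their sum when both fail.
        -- Each is orthogonal to the earlier pairs, as are `x` and `e k`.
        by_cases h1 : B x (f k) = 0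
        · by_cases h2 : B z (e k) = 0
          · obtain ⟨h, hh, hhx, hhw⟩ := hmove2 x (f k + z) (e k)
              (by rw [map_add, h1, hxz]; simp)
              (by rw [map_add, LinearMap.add_apply, h2, hkk]; simp)
            refine ⟨h, hh, hhx, fun i hi => ⟨hhw _ (e1 i hi) ?_, hhw _ (e2 i hi) ?_⟩⟩
            · rw [map_add, LinearMap.add_apply, e3 i hi, e5 i hi, hee, add_zero]
            · rw [map_add, LinearMap.add_apply, e4 i hi, e6 i hi, hef, if_neg (hne i hi), add_zero]
          · obtain ⟨h, hh, hhx, hhw⟩ := hmove2 x z (e k) (by rw [hxz]; simp) h2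
            exact ⟨h, hh, hhx, fun i hi =>
              ⟨hhw _ (e1 i hi) (e5 i hi), hhw _ (e2 i hi) (e6 i hi)⟩⟩
        · obtain ⟨h, hh, hhx, hhw⟩ := hmove2 x (f k) (e k) h1 (by rw [hkk]; simp)
          exact ⟨h, hh, hhx, fun i hi =>
            ⟨hhw _ (e1 i hi) (e3 i hi), hhw _ (e2 i hi) (e4 i hi)⟩⟩
      obtain ⟨D, hD⟩ : ∃ D, D = h * (C * A) := ⟨_, rfl⟩
      have hDe : ∀ i ∈ s, mat D *ᵥ e i = e i := fun i hi => by
        rw [hD, mat_mul_mulVec, (hCA i hi).1, (hhw i hi).1]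
      have hDf : ∀ i ∈ s, mat D *ᵥ f i = f i := fun i hi => by
        rw [hD, mat_mul_mulVec, (hCA i hi).2, (hhw i hi).2]
      have hDk : mat D *ᵥ e k = e k := by rw [hD, mat_mul_mulVec, ← hx, hhx]
      have hyk : B (mat D *ᵥ f k) (e k) = B (f k) (e k) := by
        conv_lhs => rw [← hDk]
        exact bil_mat _ _ _
      obtain ⟨a, ha, hax, hak, haw⟩ : ∃ a ∈ S, mat a *ᵥ mat D *ᵥ f k = f k ∧
          mat a *ᵥ e k = e k ∧ ∀ i ∈ s, mat a *ᵥ e i = e i ∧ mat a *ᵥ f i = f i := by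
        -- The vector `f k + e k` has the same pairing with `e k` as `f k` has, so the detour
        -- through it keeps `e k` fixed.
        by_cases h1 : B (mat D *ᵥ f k) (f k) = 0
        · obtain ⟨a, ha, hax, haw⟩ := hmove2 (mat D *ᵥ f k) (f k + e k) (f k)
            (by rw [map_add, h1, hyk, hkk]; simp)
            (by rw [map_add, LinearMap.add_apply, halt, hkk']; simp)
          refine ⟨a, ha, hax, haw _ hyk ?_, fun i hi => ⟨haw _ (hBe D hDe _ i hi) ?_,
            haw _ (hBf D hDf _ i hi) ?_⟩⟩
          · rw [map_add, LinearMap.add_apply, halt, add_zero]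
          · rw [map_add, LinearMap.add_apply, hee, add_zero]
          · rw [map_add, LinearMap.add_apply, hef, if_neg (hne i hi), add_zero]
        · obtain ⟨a, ha, hax, haw⟩ := hmove1 _ _ h1
          exact ⟨a, ha, hax, haw _ hyk, fun i hi =>
            ⟨haw _ (hBe D hDe _ i hi), haw _ (hBf D hDf _ i hi)⟩⟩
      refine ⟨a * (h * C), S.mul_mem ha (S.mul_mem hh hC), fun i hi => ?_⟩
      rw [show a * (h * C) * A = a * D by simp only [hD, mul_assoc], mat_mul_mulVec,
        mat_mul_mulVec]
      rcases Finset.mem_insert.1 hi with rfl | hi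
      · exact ⟨by rw [hDk, hak], hax⟩
      · rw [hDe i hi, hDf i hi]
        exact haw i hi
  obtain ⟨C, hC, hCA⟩ := key Finset.univ
  refine ⟨C, hC, eq_one_of_fixes_basis (Pi.basisFun ℂ _) _ fun i => ?_⟩
  rcases i with i | i
  · simpa [e] using (hCA i (Finset.mem_univ i)).1
  · simpa [f] using (hCA i (Finset.mem_univ i)).2

theorem submonoid_eq_top_of_transvections (S : Submonoid (points T g ℂ))
    (hS : ∀ u t h, transvection (T := T) (g := g) u t h ∈ S) : S = ⊤ := by
  cases T
  · exact symplectic_generation S hS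
  · exact orthogonal_generation S hS

end Generation

/-! ### From `Γ` to `𝔾(ℝ)` to `𝔾(ℂ)`. -/

section Density

open Matrix

variable {T : ClassicalType} {g : ℕ} {E : Type*} [AddCommGroup E] [Module ℂ E]

theorem exists_real_point {A : points T g ℂ}
    (hA : ∀ i j, (starRingEnd ℂ) (mat A i j) = mat A i j) :
    ∃ A' : points T g ℝ, pointsMap T g Complex.ofRealHom A' = A := by
  let M : Matrix (Fin g ⊕ Fin g) (Fin g ⊕ Fin g) ℝ := Matrix.of fun i j => (mat A i j).re
  have hM : M.map Complex.ofRealHom = mat A := by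
    ext i j
    exact Complex.conj_eq_iff_re.1 (hA i j)
  have h : Mᵀ * form T g ℝ * M = form T g ℝ := by
    apply Matrix.map_injective (f := Complex.ofRealHom) Complex.ofReal_injective
    change (Mᵀ * form T g ℝ * M).map Complex.ofRealHom = (form T g ℝ).map Complex.ofRealHom
    rw [Matrix.map_mul, Matrix.map_mul, transpose_map, hM, form_map]
    exact mat_form A
  exact ⟨mkPoint M h, mat_injective hM⟩

theorem transvectionMatrix_apply (u : Fin g ⊕ Fin g → ℂ) (t : ℂ) (i j : Fin g ⊕ Fin g) :
    transvectionMatrix T u t i j =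
      (1 : Matrix (Fin g ⊕ Fin g) (Fin g ⊕ Fin g) ℂ) i j +
        t * (u i * ∑ k, u k * form T g ℂ k j) := rfl

theorem transvectionMatrix_conj {u : Fin g ⊕ Fin g → ℂ} {t : ℂ}
    (hu : ∀ i, (starRingEnd ℂ) (u i) = u i) (ht : (starRingEnd ℂ) t = t) (i j : Fin g ⊕ Fin g) :
    (starRingEnd ℂ) (transvectionMatrix T u t i j) = transvectionMatrix T u t i j := by
  have h1 : ∀ i j, (starRingEnd ℂ) (form T g ℂ i j) = form T g ℂ i j := fun i j =>
    congrFun (congrFun (form_map T g (starRingEnd ℂ)) i) j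
  have h2 : (starRingEnd ℂ) ((1 : Matrix (Fin g ⊕ Fin g) (Fin g ⊕ Fin g) ℂ) i j) =
      (1 : Matrix (Fin g ⊕ Fin g) (Fin g ⊕ Fin g) ℂ) i j := by
    rw [one_apply]; split_ifs <;> simp
  simp only [transvectionMatrix_apply, map_add, map_mul, map_sum, hu, ht, h1, h2]

theorem transvectionMatrix_differentiableAt {u : ℂ → Fin g ⊕ Fin g → ℂ} {t : ℂ → ℂ} {z : ℂ}
    (hu : ∀ i, DifferentiableAt ℂ (fun w => u w i) z) (ht : DifferentiableAt ℂ t z)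
    (i j : Fin g ⊕ Fin g) :
    DifferentiableAt ℂ (fun w => transvectionMatrix T (u w) (t w) i j) z := by
  simp only [transvectionMatrix_apply]
  fun_prop

theorem bil_differentiable {u : ℂ → Fin g ⊕ Fin g → ℂ} (hu : ∀ i, Differentiable ℂ fun w => u w i) :
    Differentiable ℂ fun z => bil T g (u z) (u z) := by
  simp only [bil_apply, dotProduct, mulVec]
  fun_prop

theorem bil_conj {u : Fin g ⊕ Fin g → ℂ} (hu : ∀ i, (starRingEnd ℂ) (u i) = u i) :
    (starRingEnd ℂ) (bil T g u u) = bil T g u u := by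
  have h1 : ∀ i j, (starRingEnd ℂ) (form T g ℂ i j) = form T g ℂ i j := fun i j =>
    congrFun (congrFun (form_map T g (starRingEnd ℂ)) i) j
  simp only [bil_apply, dotProduct, mulVec, map_sum, map_mul, hu, h1]

/-- A subspace stable under the real points is stable under all points of a holomorphic curve that
is real on the real axis. -/
theorem stable_of_curve {R : Representation ℂ (points T g ℂ) E} (hR : IsHolomorphicRep R)
    {F : Submodule ℂ E}
    (hF : ∀ A : points T g ℝ, ∀ v ∈ F, R (pointsMap T g Complex.ofRealHom A) v ∈ F)
    {D : Set ℂ} (hD : IsOpen D) (hDc : Dᶜ.Finite) (c : ℂ → points T g ℂ)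
    (M : ℂ → Matrix (Fin g ⊕ Fin g) (Fin g ⊕ Fin g) ℂ) (hc : ∀ z ∈ D, mat (c z) = M z)
    (hM : ∀ z ∈ D, ∀ i j, DifferentiableAt ℂ (fun w => M w i j) z)
    (hreal : ∀ t : ℝ, (t : ℂ) ∈ D → ∀ i j, (starRingEnd ℂ) (M t i j) = M t i j)
    {z : ℂ} (hz : z ∈ D) : ∀ v ∈ F, R (c z) v ∈ F := by
  intro v hv
  by_contra hcon
  obtain ⟨η, hη, hη'⟩ := Submodule.exists_le_ker_of_notMem hcon
  refine hη ?_
  have han : AnalyticOnNhd ℂ (fun w => η (R (c w) v)) D := by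
    refine DifferentiableOn.analyticOnNhd (fun w hw => ?_) hD
    refine DifferentiableAt.differentiableWithinAt ?_
    exact IsHolFun.differentiableAt_comp (hR v η)
      (Filter.eventually_of_mem (hD.mem_nhds hw) hc) (hM w hw)
  -- The plane minus finitely many points is connected, so the identity theorem carries vanishing at
  -- the real points of `D` to all of `D`.
  have hconn : IsPreconnected D := by
    have := (hDc.countable.isPathConnected_compl_of_one_lt_rank
      (by rw [Complex.rank_real_complex]; exact Cardinal.one_lt_two)).isConnected.isPreconnected
    rwa [compl_compl] at this
  obtain ⟨t, ht⟩ : ∃ t : ℝ, (t : ℂ) ∈ D := by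
    by_contra hno
    push Not at hno
    exact Set.infinite_univ
      ((hDc.preimage Complex.ofReal_injective.injOn).subset fun t _ => hno t)
  have hzero : ∀ s : ℝ, (s : ℂ) ∈ D → η (R (c s) v) = 0 := by
    intro s hs
    obtain ⟨A', hA'⟩ := exists_real_point (A := c s) (by rw [hc _ hs]; exact hreal s hs)
    rw [← hA']
    exact hη' (hF A' v hv)
  have hfreq : ∃ᶠ w in nhdsWithin (t : ℂ) {(t : ℂ)}ᶜ, η (R (c w) v) = 0 := by
    have hcont : Filter.Tendsto (fun s : ℝ => (s : ℂ)) (nhdsWithin t {t}ᶜ)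
        (nhdsWithin (t : ℂ) {(t : ℂ)}ᶜ) := by
      refine tendsto_nhdsWithin_of_tendsto_nhds_of_eventually_within _
        (tendsto_nhdsWithin_of_tendsto_nhds (Complex.continuous_ofReal.tendsto t)) ?_
      filter_upwards [self_mem_nhdsWithin] with s hs
      simpa using hs
    refine hcont.frequently (Filter.Eventually.frequently ?_)
    filter_upwards [nhdsWithin_le_nhds
      (Complex.continuous_ofReal.continuousAt.preimage_mem_nhds (hD.mem_nhds ht))] with s hs
    exact hzero s hs
  exact han.eqOn_zero_of_preconnected_of_frequently_eq_zero hconn ht hfreq hz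

/-- Write `u = x + iy` with `x`, `y` real and use the curve `U z = x + z y`, real for real `z` and
equal to `u` at `z = i`. In the symplectic case `t` is deformed the same way; in the orthogonal
case, if `t ≠ 0`, it must be `-2 / B(U z, U z)`, whose denominator is a polynomial in `z` that is
nonzero at `i`. -/
theorem stable_transvection {R : Representation ℂ (points T g ℂ) E} (hR : IsHolomorphicRep R)
    {F : Submodule ℂ E}
    (hF : ∀ A : points T g ℝ, ∀ v ∈ F, R (pointsMap T g Complex.ofRealHom A) v ∈ F)
    (u : Fin g ⊕ Fin g → ℂ) (t : ℂ) (h : t * (1 + T.sign ℂ) + t * t * bil T g u u = 0) :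
    ∀ v ∈ F, R (transvection u t h) v ∈ F := by
  let U : ℂ → Fin g ⊕ Fin g → ℂ := fun z i => (u i).re + z * (u i).im
  have hU : ∀ i, Differentiable ℂ fun w => U w i := fun i => by
    simp only [U]
    fun_prop
  have hUi : U Complex.I = u := by
    ext i
    simp only [U]
    rw [mul_comm, Complex.re_add_im]
  have hUr : ∀ (s : ℝ) i, (starRingEnd ℂ) (U s i) = U s i := fun s i => by
    simp [U]
  cases T with
  | symplectic =>
    have hval : ∀ (x : Fin g ⊕ Fin g → ℂ) (s : ℂ), s * (1 + ClassicalType.symplectic.sign ℂ) +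
        s * s * bil .symplectic g x x = 0 := by
      intro x s
      have h1 : bil .symplectic g x x = 0 :=
        self_eq_neg.1 ((bil_swap x x).trans (by simp [ClassicalType.sign]))
      rw [h1]
      simp [ClassicalType.sign]
    let τ : ℂ → ℂ := fun z => t.re + z * t.im
    have hτi : τ Complex.I = t := by
      simp only [τ]
      rw [mul_comm, Complex.re_add_im]
    have key := stable_of_curve hR hF isOpen_univ (by simp)
      (fun z => transvection (U z) (τ z) (hval _ _)) (fun z => transvectionMatrix _ (U z) (τ z))
      (fun z _ => rfl)
      (fun z _ => transvectionMatrix_differentiableAt (fun i => hU i z)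
        (by simp only [τ]; fun_prop))
      (fun s _ => transvectionMatrix_conj (hUr s) (by simp [τ])) (Set.mem_univ Complex.I)
    have heq : transvection u t h = transvection (U Complex.I) (τ Complex.I) (hval _ _) :=
      mat_injective (by
        change transvectionMatrix _ u t = transvectionMatrix _ (U Complex.I) (τ Complex.I)
        rw [hUi, hτi])
    rwa [heq]
  | orthogonal =>
    by_cases ht : t = 0
    · have : transvection u t h = 1 := by
        apply mat_injective
        simp [transvection, transvectionMatrix, ht]
      intro v hv
      rw [this, map_one]
      exact hv
    let q : ℂ → ℂ := fun z => bil .orthogonal g (U z) (U z)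
    have h2 : 2 + t * bil .orthogonal g u u = 0 := by
      have : t * (2 + t * bil .orthogonal g u u) = 0 := by
        rw [← h]; simp only [ClassicalType.sign]; ring
      exact (mul_eq_zero.1 this).resolve_left ht
    have hqi : q Complex.I ≠ 0 := by
      intro h0
      simp only [q, hUi] at h0
      rw [h0] at h2
      norm_num at h2
    have hti : -2 / q Complex.I = t := by
      rw [div_eq_iff hqi]
      simp only [q, hUi]
      linear_combination -h2
    have hq : Differentiable ℂ q := bil_differentiable hU
    have hval : ∀ z, q z ≠ 0 → -2 / q z * (1 + ClassicalType.orthogonal.sign ℂ) +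
        -2 / q z * (-2 / q z) * bil .orthogonal g (U z) (U z) = 0 := by
      intro z hz
      change -2 / q z * (1 + 1) + -2 / q z * (-2 / q z) * q z = 0
      field_simp
      ring
    have hfin : {z | q z ≠ 0}ᶜ.Finite := by
      let x : Fin g ⊕ Fin g → ℂ := fun i => (u i).re
      let y : Fin g ⊕ Fin g → ℂ := fun i => (u i).im
      have hUz : ∀ z, U z = x + z • y := fun z => rfl
      let p : Polynomial ℂ := Polynomial.C (bil .orthogonal g x x) +
        Polynomial.C (bil .orthogonal g x y + bil .orthogonal g y x) * Polynomial.X +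
        Polynomial.C (bil .orthogonal g y y) * Polynomial.X ^ 2
      have hp : ∀ z, p.eval z = q z := by
        intro z
        simp only [p, q, hUz, map_add, map_smul, LinearMap.add_apply, LinearMap.smul_apply,
          smul_eq_mul, Polynomial.eval_add, Polynomial.eval_mul, Polynomial.eval_C,
          Polynomial.eval_X, Polynomial.eval_pow]
        ring
      have hp0 : p ≠ 0 := by
        intro h0
        apply hqi
        rw [← hp, h0, Polynomial.eval_zero]
      refine (Polynomial.finite_setOfPred_isRoot hp0).subset fun z hz => ?_
      have hz' : q z = 0 := by simpa using hz
      exact (hp z).trans hz'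
    classical
    -- At the zeros of `q` the curve takes the dummy value `1`; these points lie outside the domain.
    have key := stable_of_curve hR hF (hq.continuous.isOpen_preimage _ isOpen_ne) hfin
      (fun z => if hz : q z ≠ 0 then transvection (U z) (-2 / q z) (hval z hz) else 1)
      (fun z => transvectionMatrix _ (U z) (-2 / q z))
      (fun z hz => by
        have hz' : q z ≠ 0 := hz
        rw [dif_pos hz']
        rfl)
      (fun z hz => transvectionMatrix_differentiableAt (fun i => hU i z)
        ((differentiableAt_const _).div (hq z) hz))
      (fun s _ => transvectionMatrix_conj (hUr s) (by
        rw [map_div₀]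
        congr 1
        · rw [map_neg, map_ofNat]
        · exact bil_conj (hUr s))) (z := Complex.I) hqi
    rw [dif_pos hqi] at key
    have heq : transvection u t h =
        transvection (U Complex.I) (-2 / q Complex.I) (hval _ hqi) :=
      mat_injective (by
        change transvectionMatrix _ u t = transvectionMatrix _ (U Complex.I) (-2 / q Complex.I)
        rw [hUi, hti])
    rwa [heq]

theorem stable_of_real_stable {R : Representation ℂ (points T g ℂ) E} (hR : IsHolomorphicRep R)
    {F : Submodule ℂ E}
    (hF : ∀ A : points T g ℝ, ∀ v ∈ F, R (pointsMap T g Complex.ofRealHom A) v ∈ F)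
    (A : points T g ℂ) : ∀ v ∈ F, R A v ∈ F := by
  let S : Submonoid (points T g ℂ) :=
    { carrier := {A | ∀ v ∈ F, R A v ∈ F}
      one_mem' := fun v hv => by rwa [map_one]
      mul_mem' := fun {a b} ha hb v hv => by
        rw [map_mul]
        exact ha _ (hb v hv) }
  have hS : S = ⊤ := submonoid_eq_top_of_transvections S (stable_transvection hR hF)
  have : A ∈ S := by rw [hS]; trivial
  exact this

theorem exists_real_im_polynomials {σ : Type*} (p : MvPolynomial σ ℂ) :
    ∃ p₁ p₂ : MvPolynomial σ ℝ, ∀ x : σ → ℝ, MvPolynomial.eval (fun i => (x i : ℂ)) p =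
      (MvPolynomial.eval x p₁ : ℂ) + (MvPolynomial.eval x p₂ : ℂ) * Complex.I := by
  induction p using MvPolynomial.induction_on with
  | C a => exact ⟨.C a.re, .C a.im, fun x => by simp⟩
  | add p q hp hq =>
    obtain ⟨p₁, p₂, hp⟩ := hp
    obtain ⟨q₁, q₂, hq⟩ := hq
    refine ⟨p₁ + q₁, p₂ + q₂, fun x => ?_⟩
    simp only [map_add, hp, hq, Complex.ofReal_add]
    ring
  | mul_X p i hp =>
    obtain ⟨p₁, p₂, hp⟩ := hp
    refine ⟨p₁ * .X i, p₂ * .X i, fun x => ?_⟩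
    simp only [map_mul, hp, MvPolynomial.eval_X, Complex.ofReal_mul]
    ring

/-- A functional killing `F`, evaluated on the orbit of a vector of `F`, is a polynomial in the
matrix entries vanishing on `Γ`. Density concerns real polynomials, hence the splitting into real
and imaginary parts. -/
theorem stable_of_isZariskiDense [Module.Finite ℂ E] {Γ : Subgroup (points T g ℝ)}
    (hΓ : IsZariskiDense Γ) {R : Representation ℂ (points T g ℂ) E} (hR : IsHolomorphicRep R)
    {F : Submodule ℂ E}
    (hF : ∀ A ∈ Γ, ∀ v ∈ F, R (pointsMap T g Complex.ofRealHom A) v ∈ F)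
    (A : points T g ℂ) : ∀ v ∈ F, R A v ∈ F := by
  refine stable_of_real_stable hR (fun A v hv => ?_) A
  by_contra hcon
  obtain ⟨η, hη, hη'⟩ := Submodule.exists_le_ker_of_notMem hcon
  refine hη ?_
  obtain ⟨p, hp⟩ := mem_polynomialFunctions.1 (hR.coefficient_mem v η)
  obtain ⟨p₁, p₂, hp'⟩ := exists_real_im_polynomials p
  have hev : ∀ B : points T g ℝ, η (R (pointsMap T g Complex.ofRealHom B) v) =
      (MvPolynomial.eval (fun ij => mat B ij.1 ij.2) p₁ : ℂ) +
        (MvPolynomial.eval (fun ij => mat B ij.1 ij.2) p₂ : ℂ) * Complex.I :=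
    fun B => (hp _).symm.trans (hp' fun ij => mat B ij.1 ij.2)
  have hzero : ∀ B ∈ Γ, MvPolynomial.eval (fun ij => mat B ij.1 ij.2) p₁ = 0 ∧
      MvPolynomial.eval (fun ij => mat B ij.1 ij.2) p₂ = 0 := by
    intro B hB
    have h0 : η (R (pointsMap T g Complex.ofRealHom B) v) = 0 := hη' (hF B hB v hv)
    rw [hev] at h0
    exact ⟨by simpa using congrArg Complex.re h0, by simpa using congrArg Complex.im h0⟩
  rw [hev, hΓ p₁ (fun B hB => (hzero B hB).1) A, hΓ p₂ (fun B hB => (hzero B hB).2) A]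
  simp

end Density

/-! ### Semisimplicity, subrepresentations and quotients. -/

section Subquotients

open scoped MonoidAlgebra

theorem isIrreducible_ofSubmodule' {G E : Type*} [Group G] [AddCommGroup E] [Module ℂ E]
    (r : Representation ℂ G E) (N : Submodule ℂ[G] r.asModule) [hN : IsSimpleModule ℂ[G] N] :
    (Subrepresentation.ofSubmodule' N).toRepresentation.IsIrreducible := by
  rw [isSimpleModule_iff_isAtom] at hN
  have hne : N ≠ ⊥ := hN.1
  refine { exists_pair_ne := ⟨⊥, ⊤, fun h => hne ?_⟩, eq_bot_or_eq_top := fun σ => ?_ }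
  · rw [eq_bot_iff]
    intro x hx
    have h1 : (⟨x, hx⟩ : (Subrepresentation.ofSubmodule' N).toSubmodule) ∈
        (⊤ : Subrepresentation (Subrepresentation.ofSubmodule' N).toRepresentation).toSubmodule :=
      Submodule.mem_top
    rw [← h] at h1
    exact congrArg Subtype.val ((Submodule.mem_bot ℂ).1 h1)
  -- Pushed forward to `E`, `σ` lies below the atom `N`, so it is zero or all of `N`.
  · let σ' : Subrepresentation r :=
      ⟨σ.toSubmodule.map (Subrepresentation.ofSubmodule' N).toSubmodule.subtype, by
        rintro a _ ⟨x, hx, rfl⟩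
        exact ⟨_, σ.apply_mem_toSubmodule a hx, rfl⟩⟩
    have hmem : ∀ (x : E) (hx : x ∈ N),
        x ∈ σ' ↔ (⟨x, hx⟩ : (Subrepresentation.ofSubmodule' N).toSubmodule) ∈
          σ.toSubmodule := by
      intro x hx
      constructor
      · rintro ⟨y, hy, hyx⟩
        have : y = ⟨x, hx⟩ := Subtype.ext hyx
        exact this ▸ hy
      · exact fun h => ⟨_, h, rfl⟩
    have hle : σ'.asSubmodule ≤ N := by
      rintro _ ⟨y, _, rfl⟩
      exact y.2
    rcases hN.le_iff.1 hle with h | h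
    · left
      apply Subrepresentation.toSubmodule_injective
      refine (Submodule.eq_bot_iff _).2 fun x hx => ?_
      have hx' : (x.1 : r.asModule) ∈ σ'.asSubmodule := (hmem x.1 x.2).2 hx
      rw [h] at hx'
      have hx0 : (x.1 : r.asModule) = 0 := (Submodule.mem_bot ℂ[G] (M := r.asModule)).1 hx'
      exact Subtype.ext hx0
    · right
      apply Subrepresentation.toSubmodule_injective
      refine Submodule.eq_top_iff'.2 fun x => ?_
      have hx' : (x.1 : r.asModule) ∈ σ'.asSubmodule := by
        rw [h]
        exact x.2
      exact (hmem x.1 x.2).1 hx'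

theorem exists_isInternal_irreducible {G E : Type*} [Group G] [AddCommGroup E] [Module ℂ E]
    [Module.Finite ℂ E] (r : Representation ℂ G E) (h : r.IsSemisimpleRepresentation) :
    ∃ (n : ℕ) (W : Fin n → Subrepresentation r),
      (∀ i, (W i).toRepresentation.IsIrreducible) ∧
        DirectSum.IsInternal fun i => (W i).toSubmodule := by
  rw [Representation.isSemisimpleRepresentation_iff_isSemisimpleModule_asModule] at h
  have : IsNoetherian ℂ r.asModule := inferInstanceAs (IsNoetherian ℂ E)
  have hno : IsNoetherian ℂ[G] r.asModule := isNoetherian_of_tower ℂ this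
  obtain ⟨s, hs, htop, hsimple⟩ :=
    IsSemisimpleModule.exists_sSupIndep_sSup_simples_eq_top ℂ[G] r.asModule
  -- An independent family of simple submodules of a Noetherian module is finite.
  have hfin : s.Finite := WellFoundedGT.finite_of_sSupIndep hs
  have := hfin.fintype
  let e := (Fintype.equivFin s).symm
  refine ⟨Fintype.card s, fun i => Subrepresentation.ofSubmodule' (e i).1, fun i => ?_, ?_⟩
  · have := hsimple (e i).1 (e i).2
    exact isIrreducible_ofSubmodule' r (e i).1
  · have h1 : DirectSum.IsInternal fun i => (e i).1 := by
      refine DirectSum.isInternal_submodule_of_iSupIndep_of_iSup_eq_top ?_ ?_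
      · exact ((sSupIndep_iff s).1 hs).comp e.injective
      · rw [← htop, sSup_eq_iSup', e.iSup_comp (g := fun x : s => x.1)]
    exact h1

variable {T : ClassicalType} {g : ℕ} {E : Type*} [AddCommGroup E] [Module ℂ E]
  {Γ : Subgroup (points T g ℝ)} {r : Representation ℂ Γ E}
  {R : Representation ℂ (points T g ℂ) E}

/-- A subrepresentation of `Γ` is a subrepresentation of `𝔾(ℂ)`. -/
def extendSubrepresentation [Module.Finite ℂ E] (hΓ : IsZariskiDense Γ)
    (hR : IsHolomorphicExtension r R) (F : Subrepresentation r) : Subrepresentation R :=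
  ⟨F.toSubmodule, fun A => stable_of_isZariskiDense hΓ hR.1 (fun A hA v hv => by
    rw [hR.2 ⟨A, hA⟩]
    exact F.apply_mem_toSubmodule _ hv) A⟩

/-- The complement of `F` is the kernel of a `𝔾(ℂ)`-equivariant projection onto it. -/
theorem isSemisimpleRepresentation_of_isHolomorphicExtension [Module.Finite ℂ E]
    (hΓ : IsZariskiDense Γ) (hR : IsHolomorphicExtension r R) : r.IsSemisimpleRepresentation := by
  refine ⟨fun F => ?_⟩
  obtain ⟨π, h1, h2, h3⟩ := exists_equivariant_projection hR.1 F.toSubmodule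
    (extendSubrepresentation hΓ hR F).apply_mem_toSubmodule
  refine ⟨⟨LinearMap.ker π, fun γ v hv => ?_⟩, ?_, ?_⟩
  · rw [LinearMap.mem_ker] at hv ⊢
    rw [← hR.2, h3, hv, map_zero]
  · rw [disjoint_iff_inf_le]
    rintro x ⟨hx, hx'⟩
    exact (Submodule.mem_bot ℂ).2 ((h2 x hx).symm.trans hx')
  · rw [codisjoint_iff_le_sup]
    intro x _
    refine Submodule.mem_sup.2 ⟨π x, h1 x, x - π x, ?_, by abel⟩
    change π (x - π x) = 0
    rw [map_sub, h2 _ (h1 x), sub_self]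

theorem isHolomorphicExtension_subrepresentation [Module.Finite ℂ E] (hΓ : IsZariskiDense Γ)
    (hR : IsHolomorphicExtension r R) (F : Subrepresentation r) :
    IsHolomorphicExtension F.toRepresentation
      (extendSubrepresentation hΓ hR F).toRepresentation := by
  refine ⟨fun v φ => ?_, fun γ => LinearMap.ext fun v => Subtype.ext ?_⟩
  · obtain ⟨ψ, rfl⟩ := LinearMap.exists_extend φ
    exact hR.1 v.1 ψ
  · exact LinearMap.congr_fun (hR.2 γ) v.1

theorem separatedInDegree_subrepresentation (F : Subrepresentation R) {k : ℕ}
    (h : SeparatedInDegree R k) : SeparatedInDegree F.toRepresentation k :=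
  fun v hv => Subtype.ext (h v.1 fun i hi φ hφ =>
    hv i hi (φ ∘ₗ F.toSubmodule.subtype) fun A x => hφ A x.1)

theorem isHolomorphicExtension_quotient [Module.Finite ℂ E] (hΓ : IsZariskiDense Γ)
    (hR : IsHolomorphicExtension r R) (F : Subrepresentation r) :
    IsHolomorphicExtension (quotientRep F) (quotientRep (extendSubrepresentation hΓ hR F)) := by
  refine ⟨fun v φ => ?_, fun γ => LinearMap.ext fun v => ?_⟩
  · obtain ⟨x, rfl⟩ := Submodule.mkQ_surjective _ v
    exact hR.1 x (φ ∘ₗ Submodule.mkQ _)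
  · obtain ⟨x, rfl⟩ := Submodule.mkQ_surjective _ v
    exact congrArg (Submodule.mkQ F.toSubmodule) (LinearMap.congr_fun (hR.2 γ) x)

/-- For an equivariant projection `π` onto `F`, each equivariant `φ` on `E` gives `φ ∘ (1 - π)`,
which descends to `E / F`. If all of these kill the class of `x`, then `x = π x` lies in `F`. -/
theorem separatedInDegree_quotient [Module.Finite ℂ E] (hR : IsHolomorphicRep R)
    (F : Subrepresentation R) {k : ℕ} (h : SeparatedInDegree R k) :
    SeparatedInDegree (quotientRep F) k := by
  obtain ⟨π, h1, h2, h3⟩ := exists_equivariant_projection hR F.toSubmodule F.apply_mem_toSubmodule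
  intro v hv
  obtain ⟨x, rfl⟩ := Submodule.mkQ_surjective _ v
  have hx : x - π x = 0 := by
    refine h _ fun i hi φ hφ => ?_
    refine hv i hi (F.toSubmodule.liftQ (φ ∘ₗ (LinearMap.id - π)) fun y hy => ?_) fun A y => ?_
    · simp [h2 y hy]
    · obtain ⟨y, rfl⟩ := Submodule.mkQ_surjective _ y
      change φ (R A y - π (R A y)) = tensorPowerRep T g i A (φ (y - π y))
      rw [h3, ← map_sub, hφ]
  rw [Submodule.mkQ_apply, Submodule.Quotient.mk_eq_zero, sub_eq_zero.1 hx]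
  exact h1 x

end Subquotients

end ArithRep

theorem mainTheorem11 (T : ArithRep.ClassicalType) (g : ℕ)
    (Γ : Subgroup (ArithRep.points T g ℝ))
    (hΓ : ArithRep.IsArithmeticSubgroup Γ) (hdense : ArithRep.IsZariskiDense Γ)
    {E : Type*} [AddCommGroup E] [Module ℂ E] (r : Representation ℂ Γ E)
    (hr : ArithRep.IsArithmeticRep r) :
    (∃ k : ℕ, ArithRep.IsArithmeticRepOfDegreeLE r k) ∧
    (∃ (n : ℕ) (W : Fin n → Subrepresentation r),
      (∀ i, (W i).toRepresentation.IsIrreducible) ∧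
        DirectSum.IsInternal fun i => (W i).toSubmodule) ∧
    (∀ F : Subrepresentation r,
      ArithRep.IsArithmeticRep F.toRepresentation ∧
        ∀ k : ℕ, ArithRep.IsArithmeticRepOfDegreeLE r k →
          ArithRep.IsArithmeticRepOfDegreeLE F.toRepresentation k) ∧
    (∀ F : Subrepresentation r,
      ArithRep.IsArithmeticRep (ArithRep.quotientRep F) ∧
        ∀ k : ℕ, ArithRep.IsArithmeticRepOfDegreeLE r k →
          ArithRep.IsArithmeticRepOfDegreeLE (ArithRep.quotientRep F) k) := by
  obtain ⟨hfin, R, hR⟩ := hr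
  refine ⟨?_, ?_, fun F => ⟨?_, fun k hk => ?_⟩, fun F => ⟨?_, fun k hk => ?_⟩⟩
  · obtain ⟨k, hk⟩ := ArithRep.exists_separatedInDegree hR.1
    exact ⟨k, ArithRep.isArithmeticRepOfDegreeLE_iff.2 ⟨hfin, R, hR, hk⟩⟩
  · exact ArithRep.exists_isInternal_irreducible r
      (ArithRep.isSemisimpleRepresentation_of_isHolomorphicExtension hdense hR)
  · exact ⟨inferInstance, _, ArithRep.isHolomorphicExtension_subrepresentation hdense hR F⟩
  -- The degree bound comes with its own extension `R'`. The argument runs with `R'` directly, so no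
  -- comparison with `R` is needed.
  · obtain ⟨_, R', hR', hsep⟩ := ArithRep.isArithmeticRepOfDegreeLE_iff.1 hk
    exact ArithRep.isArithmeticRepOfDegreeLE_iff.2 ⟨inferInstance, _,
      ArithRep.isHolomorphicExtension_subrepresentation hdense hR' F,
      ArithRep.separatedInDegree_subrepresentation _ hsep⟩
  · exact ⟨inferInstance, _, ArithRep.isHolomorphicExtension_quotient hdense hR F⟩
  · obtain ⟨_, R', hR', hsep⟩ := ArithRep.isArithmeticRepOfDegreeLE_iff.1 hk
    exact ArithRep.isArithmeticRepOfDegreeLE_iff.2 ⟨inferInstance, _,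
      ArithRep.isHolomorphicExtension_quotient hdense hR' F,
      ArithRep.separatedInDegree_quotient hR'.1 _ hsep⟩
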